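/- **Translation property of the parametric $\alpha$-Fisher information.** *Definitions.* Let $1<\alpha\le 2$ and $d\ge 1$. For $\gamma>0$, $\mathcal S(\alpha,\gamma)$ denotes the symmetric stable law on $\mathbb R^d$ with characteristic function $\omega\mapsto e^{-\gamma^\alpha\|\omega\|^\alpha}$. For a random vector $X$ with density $p_X$, let $h(X)=-\int p_X\ln p_X$ be its differential entropy and $\phi_X(\omega)=\mathbb E\,e^{i\langle \omega,X\rangle}$ its characteristic function. If $Z\sim\mathcal S(\alpha,(1/\alpha)^{1/\alpha})$ is independent of $X$, the $\alpha$-Fisher information of $X$ is $$J_\alpha(X)=\alpha\lim_{\epsilon\to0^+}\frac{h(X+\epsilon^{1/\alpha}Z)-h(X)}{\epsilon}$$ whenever the limit exists. For $0<\nu<1$ the Riesz potential of order $\nu$ on $\mathbb R^m$ is $$I_\nu[f](x)=\frac{\Gamma\left(\frac m2-\frac\nu2\right)}{\pi^{m/2}2^\nu\Gamma\left(\frac\nu2\right)}\int_{\mathbb R^m}\|x-y\|^{-m+\nu}f(y)\,dy,$$ and $I_0[f]=f$. For a family $(Y_\theta)_{\theta\in\mathbb R^m}$ of random vectors in $\mathbb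 R^d$ with densities $p_{Y_\theta}$ (the continuous version of the density is used whenever there is one), the parametric $\alpha$-Fisher information is $$J_\alpha(Y_\theta;\theta)=-\mathbb E\left[I^{\theta}_{2-\alpha}\left[\Delta_\theta\ln p_{Y_\theta}\right](Y_\theta)\right],$$ where, for each fixed point $x\in\mathbb R^d$, the Laplacian and the Riesz potential act on the function $\theta\mapsto\ln p_{Y_\theta}(x)$ of the parameter $\theta\in\mathbb R^m$. Finally $$\mathcal F_I[g](x)=(2\pi)^{-d}\int_{\mathbb R^d}e^{i\langle\omega,x\rangle}g(\omega)\,d\omega.$$ *Assumptions.* Let $Y$ be a random vector in $\mathbb R^d$ with an everywhere positive $C^2$ density $p$, let $Z\sim\mathcal S(\alpha,(1/\alpha)^{1/\alpha})$ be independent of $Y$, and suppose that 1. $p\ln p$ and $\ln(1+\|y\|)\,p(y)$ are integrable on $\mathbb R^d$; 2. $\omega\mapsto\|\omega\|^\alpha\phi_Y(-\omega)$ is integrable on $\mathbb R^d$; 3. there is $\epsilon>0$ such that, with $Y_t=Y+t^{1/\alpha}Z$, the functions $$x\mapsto\left|\ln p_{Y_t}(x)\;\mathcal F_I\left[\|\omega\|^\alpha\phi_{Y_t}(-\omega)\right](x)\right|,\qquad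 t\in[0,\epsilon),$$ are bounded, uniformly in $t$, by one integrable function of $x$ (for almost every $x$); 4. as $R\to\infty$, with $n$ the outward unit normal of the sphere $\|y\|=R$, $$\int_{\|y\|=R}\ln p\;\nabla I_{2-\alpha}[p]\cdot n\,dS\to0\quad\text{and}\quad\int_{\|y\|=R}I_{2-\alpha}[p]\;\nabla\ln p\cdot n\,dS\to0;$$ 5. $|\Delta\ln p|\;I_{2-\alpha}[p]$ is integrable on $\mathbb R^d$. *Theorem.* Take $m=d$ and $Y_\theta=Y+\theta$ for $\theta\in\mathbb R^d$. Then the limit defining $J_\alpha(Y)$ exists (in $\mathbb R$), and for every $\theta\in\mathbb R^d$ the integrals defining $J_\alpha(Y_\theta;\theta)$ converge absolutely (the Riesz potential almost surely, and then the expectation), and $$J_\alpha(Y_\theta;\theta)=J_\alpha(Y).$$ -/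

import Mathlib

open MeasureTheory ProbabilityTheory Filter Topology
open scoped InnerProductSpace Gradient

noncomputable section

namespace AlphaFisher

/-- `ℝᵈ` with its Euclidean structure. -/
abbrev E (d : ℕ) : Type := EuclideanSpace ℝ (Fin d)

open Classical in
/-- The probability density function of a law `μ` on `ℝᵈ`: the continuous version of the density
with respect to Lebesgue measure whenever there is one (it is then unique), and the
Radon-Nikodym derivative otherwise. -/
def density {d : ℕ} (μ : Measure (E d)) : E d → ℝ :=
  if h : ∃ p : E d → ℝ, Continuous p ∧ (∀ x, 0 ≤ p x) ∧
      μ = volume.withDensity (fun x => ENNReal.ofReal (p x)) then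
    h.choose
  else fun x => (μ.rnDeriv volume x).toReal

/-- The differential entropy `h = -∫ p ln p` (in nats) of a law with density `p`. -/
def diffEntropy {d : ℕ} (μ : Measure (E d)) : ℝ :=
  -∫ x, density μ x * Real.log (density μ x)

/-- `ν` is the symmetric stable law `S(α, γ)` on `ℝᵈ`, i.e. the isotropic probability law whose
characteristic function is `exp (-γ ^ α ‖ω‖ ^ α)`. For `α = 2` it is the centred Gaussian law with
covariance `2 γ ^ 2` times the identity. -/
def IsSymmetricStable {d : ℕ} (α γ : ℝ) (ν : Measure (E d)) : Prop :=
  IsProbabilityMeasure ν ∧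
    ∀ w : E d, charFun ν w = ((Real.exp (-(γ ^ α * ‖w‖ ^ α)) : ℝ) : ℂ)

/-- `Z` is a reference symmetric stable vector: its law is `S(α, (1/α)^(1/α))`. -/
def IsReferenceStable {d : ℕ} {Ω : Type*} [MeasurableSpace Ω] (P : Measure Ω) (α : ℝ)
    (Z : Ω → E d) : Prop :=
  IsSymmetricStable α ((1 / α) ^ (1 / α)) (P.map Z)

/-- The law of `X + ε^(1/α) Z`. -/
def perturbedLaw {d : ℕ} {Ω : Type*} [MeasurableSpace Ω] (P : Measure Ω) (α : ℝ)
    (X Z : Ω → E d) (ε : ℝ) : Measure (E d) :=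
  P.map (fun ω => X ω + (ε ^ (1 / α)) • Z ω)

/-- The difference quotient of `ε ↦ h (X + ε^(1/α) Z)` at `0`. -/
def entropyQuotient {d : ℕ} {Ω : Type*} [MeasurableSpace Ω] (P : Measure Ω) (α : ℝ)
    (X Z : Ω → E d) (ε : ℝ) : ℝ :=
  (diffEntropy (perturbedLaw P α X Z ε) - diffEntropy (P.map X)) / ε

/-- The `α`-Fisher information exists: the defining limit as `ε → 0⁺` exists in `ℝ`. -/
def HasAlphaFisherInfo {d : ℕ} {Ω : Type*} [MeasurableSpace Ω] (P : Measure Ω) (α : ℝ)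
    (X Z : Ω → E d) : Prop :=
  ∃ L : ℝ, Tendsto (entropyQuotient P α X Z) (𝓝[>] 0) (𝓝 L)

/-- The `α`-Fisher information
`J_α(X) = α · lim_{ε → 0⁺} (h (X + ε^(1/α) Z) - h X) / ε`, where `Z` is a reference symmetric
stable vector independent of `X`. -/
def alphaFisherInfo {d : ℕ} {Ω : Type*} [MeasurableSpace Ω] (P : Measure Ω) (α : ℝ)
    (X Z : Ω → E d) : ℝ :=
  α * limUnder (𝓝[>] (0 : ℝ)) (entropyQuotient P α X Z)

/-- The constant `κ(ν) = π^(m/2) 2^ν Γ(ν/2) / Γ(m/2 - ν/2)` of the Riesz potential on `ℝᵐ`. -/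
def rieszConst (m : ℕ) (ν : ℝ) : ℝ :=
  Real.pi ^ ((m : ℝ) / 2) * 2 ^ ν * Real.Gamma (ν / 2) / Real.Gamma ((m : ℝ) / 2 - ν / 2)

/-- The Riesz potential of order `0 ≤ ν < 1` on `ℝᵐ`:
`I_ν f (x) = κ(ν)⁻¹ ∫ ‖x - y‖^(-m + ν) f y dy` for `ν > 0`, and `I_0 f = f`. -/
def riesz {m : ℕ} (ν : ℝ) (f : E m → ℝ) (x : E m) : ℝ :=
  if ν = 0 then f x
  else (rieszConst m ν)⁻¹ * ∫ y, ‖x - y‖ ^ (-(m : ℝ) + ν) * f y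

/-- The integral that defines `I_ν f (x)` converges absolutely (no condition for `ν = 0`). -/
def RieszConverges {m : ℕ} (ν : ℝ) (f : E m → ℝ) (x : E m) : Prop :=
  ν ≠ 0 → Integrable (fun y : E m => ‖x - y‖ ^ (-(m : ℝ) + ν) * f y)

/-- For a family `Yθ` of random vectors in `ℝᵈ` indexed by a parameter `θ ∈ ℝᵐ`, the function
`η ↦ Δ_η ln p_{Y_η}(x)` of the parameter, at a fixed point `x` of `ℝᵈ`. -/
def paramLaplacianLog {m d : ℕ} {Ω : Type*} [MeasurableSpace Ω] (P : Measure Ω)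
    (Yfam : E m → Ω → E d) (x : E d) : E m → ℝ :=
  Laplacian.laplacian (fun η : E m => Real.log (density (P.map (Yfam η)) x))

/-- The random variable `I^θ_{2-α}[Δ_θ ln p_{Y_θ}](Y_θ)`; the Riesz potential acts on the
parameter. -/
def paramScore {m d : ℕ} {Ω : Type*} [MeasurableSpace Ω] (P : Measure Ω) (α : ℝ)
    (Yfam : E m → Ω → E d) (θ : E m) (ω : Ω) : ℝ :=
  riesz (2 - α) (paramLaplacianLog P Yfam (Yfam θ ω)) θ

/-- The integrals in the definition of the parametric `α`-Fisher information converge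
absolutely: the Riesz potential almost surely, and the expectation. -/
def HasParamFisherInfo {m d : ℕ} {Ω : Type*} [MeasurableSpace Ω] (P : Measure Ω) (α : ℝ)
    (Yfam : E m → Ω → E d) (θ : E m) : Prop :=
  (∀ᵐ ω ∂P, RieszConverges (2 - α) (paramLaplacianLog P Yfam (Yfam θ ω)) θ) ∧
    Integrable (paramScore P α Yfam θ) P

/-- The parametric `α`-Fisher information
`J_α(Y_θ; θ) = -E [ I^θ_{2-α}[Δ_θ ln p_{Y_θ}](Y_θ) ]`. -/
def paramFisherInfo {m d : ℕ} {Ω : Type*} [MeasurableSpace Ω] (P : Measure Ω) (α : ℝ)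
    (Yfam : E m → Ω → E d) (θ : E m) : ℝ :=
  -∫ ω, paramScore P α Yfam θ ω ∂P

/-- The inverse Fourier transform
`(2π)^(-d) ∫ exp (i ⟪w, x⟫) ‖w‖^α φ_μ(-w) dw` of `w ↦ ‖w‖^α φ_μ(-w)`, where `φ_μ` is the
characteristic function of `μ`. -/
def fracInvFourier {d : ℕ} (α : ℝ) (μ : Measure (E d)) (x : E d) : ℂ :=
  ((2 * Real.pi : ℝ) : ℂ)⁻¹ ^ d *
    ∫ w : E d, Complex.exp (Complex.I * (⟪w, x⟫_ℝ : ℝ)) *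
      (((‖w‖ ^ α : ℝ) : ℂ) * charFun μ (-w))

/-- The flux `∫_{‖y‖ = R} V(y) · n dS(y)` of a vector field through the sphere of radius `R`, with
outward unit normal `n` and surface measure `dS`. -/
def sphereFlux {d : ℕ} (V : E d → E d) (R : ℝ) : ℝ :=
  R ^ (d - 1) * ∫ s : Metric.sphere (0 : E d) 1, ⟪V (R • (s : E d)), (s : E d)⟫_ℝ
    ∂((volume : Measure (E d)).toSphere)

end AlphaFisher

end

/-! Both informations reduce to one integral on the space of `x`, and `θ` drops out. Write `R =
I_{2-α}[p]` and `q = F_I[‖ω‖^α φ_Y(-ω)]`, which is the fractional Laplacian `(-Δ)^(α/2) p`.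

Entropy side. The characteristic function of `Y_t` is `φ_Y(ω) exp (-t‖ω‖^α/α)`, so its density `p_t`
solves `∂_t p_t = -α⁻¹ q_t`, with `q_t` the same inverse transform for `Y_t`. Since `u ln u - u` has
derivative `u' ln u` and all `p_t` have mass one, dominated convergence gives `h'(0⁺) = α⁻¹ ∫ ln p ·
q`, hence `J_α(Y) = ∫ ln p · q` (`tendsto_entropyQuotient`).

Riesz side. The potential `I_{2-α}` is the Fourier multiplier `‖ω‖^(-(2-α))` and `Δ` is `-‖ω‖^2`;
their product gives `ΔR = -q` (`contDiff_riesz_and_laplacian_riesz`). Green's identity, whose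
boundary terms vanish by assumption, turns `-∫ ln p · ΔR` into `-∫ R · Δ ln p`
(`integral_mul_laplacian_comm`). Symmetry of the Riesz kernel moves the potential off `p`, giving
`-∫ I_{2-α}[Δ ln p] · p` (`integral_riesz_mul_comm`).

Parameter side. For a translation family, `η ↦ ln p_{Y_η}(x)` is `ln p` composed with `η ↦ x - η`.
This reflection commutes with `Δ` and with the potential, and at `x = Y + θ` it carries `θ` to `Y`.
The score is therefore `I_{2-α}[Δ ln p](Y)` for every `θ` (`riesz_comp_sub_left`), and its
expectation is the integral above. -/

noncomputable section

namespace AlphaFisher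

/-! ### Fourier integrals in the normalisation of characteristic functions. -/

variable {d : ℕ}

/-- The inverse Fourier transform `(2π)^(-d) ∫ exp (i ⟪w, x⟫) g w dw`. -/
def invF (g : E d → ℂ) (x : E d) : ℂ :=
  ((2 * Real.pi : ℝ) : ℂ)⁻¹ ^ d * ∫ w : E d, Complex.exp (Complex.I * (⟪w, x⟫_ℝ : ℝ)) * g w

/-- The pairing `(v, w) ↦ -⟪v, w⟫ / (2π)`, for which Mathlib's vector-valued Fourier integral has
the kernel `exp (i ⟪v, w⟫)`. -/
def scaledInner (d : ℕ) : E d →L[ℝ] E d →L[ℝ] ℝ := (-(2 * Real.pi)⁻¹ : ℝ) • innerSL ℝ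

lemma scaledInner_apply (v w : E d) : scaledInner d v w = -(2 * Real.pi)⁻¹ * ⟪v, w⟫_ℝ := by
  simp only [scaledInner, smul_apply, smul_eq_mul]
  congr 1

lemma scaledInner_toLinearMap_apply (v w : E d) :
    (scaledInner d).toLinearMap₁₂ v w = -(2 * Real.pi)⁻¹ * ⟪v, w⟫_ℝ :=
  scaledInner_apply v w

lemma invF_eq_fourierIntegral (g : E d → ℂ) :
    invF g = fun x => ((2 * Real.pi : ℝ) : ℂ)⁻¹ ^ d *
      VectorFourier.fourierIntegral Real.fourierChar volume (scaledInner d).toLinearMap₁₂ g x := by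
  funext x
  unfold invF VectorFourier.fourierIntegral
  congr 1
  refine integral_congr_ae (Eventually.of_forall fun w => ?_)
  simp only [scaledInner_toLinearMap_apply, Circle.smul_def, smul_eq_mul,
    Real.fourierChar_apply]
  congr 2
  have : (Real.pi : ℂ) ≠ 0 := by exact_mod_cast Real.pi_ne_zero
  push_cast
  field_simp

lemma continuous_invF {g : E d → ℂ} (hg : Integrable g) : Continuous (invF g) := by
  rw [invF_eq_fourierIntegral]
  exact continuous_const.mul (VectorFourier.fourierIntegral_continuous Real.continuous_fourierChar
    (by apply (scaledInner d).continuous₂) hg)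

lemma norm_cexp_I_inner (w x : E d) : ‖Complex.exp (Complex.I * (⟪w, x⟫_ℝ : ℝ))‖ = 1 := by
  rw [mul_comm, Complex.norm_exp_ofReal_mul_I]

lemma integrable_cexp_mul {g : E d → ℂ} (hg : Integrable g) (x : E d) :
    Integrable fun w : E d => Complex.exp (Complex.I * (⟪w, x⟫_ℝ : ℝ)) * g w :=
  hg.bdd_mul (c := 1) (by fun_prop) (Eventually.of_forall fun w => (norm_cexp_I_inner w x).le)

lemma integrable_norm_pow_of_le_two {g : E d → ℂ} (hg : Integrable g)
    (hg2 : Integrable fun w => ‖w‖ ^ 2 * ‖g w‖) (n : ℕ) (hn : n ≤ 2) :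
    Integrable fun w => ‖w‖ ^ n * ‖g w‖ := by
  refine (hg.norm.add hg2).mono' (by have := hg.1; fun_prop) (Eventually.of_forall fun w => ?_)
  have h0 := norm_nonneg (g w)
  have h1 := norm_nonneg w
  simp only [Pi.add_apply, norm_mul, norm_pow, norm_norm]
  -- The case `n = 1` is `‖w‖ ≤ 1 + ‖w‖ ^ 2`.
  interval_cases n <;> nlinarith [sq_nonneg (‖w‖ - 1), mul_nonneg (sq_nonneg ‖w‖) h0,
    mul_nonneg (sq_nonneg (‖w‖ - 1)) h0]

lemma contDiff_invF {g : E d → ℂ} (hg : Integrable g)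
    (hg2 : Integrable fun w => ‖w‖ ^ 2 * ‖g w‖) : ContDiff ℝ 2 (invF g) := by
  rw [invF_eq_fourierIntegral]
  refine contDiff_const.mul (VectorFourier.contDiff_fourierIntegral (N := 2) (scaledInner d) ?_)
  intro n hn
  exact integrable_norm_pow_of_le_two hg hg2 n (by exact_mod_cast hn)

/-- Two derivatives along the `i`-th basis vector bring down `(I w_i)^2 = -w_i^2`, and these sum to
`-‖w‖^2`. -/
lemma laplacian_invF {g : E d → ℂ} (hg : Integrable g)
    (hg2 : Integrable fun w => ‖w‖ ^ 2 * ‖g w‖) (x : E d) :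
    Laplacian.laplacian (invF g) x = -invF (fun w => ((‖w‖ ^ 2 : ℝ) : ℂ) * g w) x := by
  have hI := fun (n : ℕ) (hn : n ≤ 2) => integrable_norm_pow_of_le_two hg hg2 n hn
  have hcd := VectorFourier.contDiff_fourierIntegral (N := 2) (μ := volume) (scaledInner d)
    (f := g) (fun n hn => hI n (by exact_mod_cast hn))
  have hpi : (Real.pi : ℂ) ≠ 0 := by exact_mod_cast Real.pi_ne_zero
  have h1 : invF g = ((2 * Real.pi : ℝ) : ℂ)⁻¹ ^ d •
      VectorFourier.fourierIntegral Real.fourierChar volume (scaledInner d).toLinearMap₁₂ g := by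
    rw [invF_eq_fourierIntegral]; rfl
  rw [h1, InnerProductSpace.laplacian_smul _ hcd.contDiffAt,
    InnerProductSpace.laplacian_eq_iteratedFDeriv_orthonormalBasis _
      (EuclideanSpace.basisFun (Fin d) ℝ)]
  simp only
  have h2 := VectorFourier.iteratedFDeriv_fourierIntegral (N := 2) (μ := volume) (scaledInner d)
    (f := g) (fun n hn => hI n (by exact_mod_cast hn)) hg.1 (n := 2) le_rfl
  rw [h2]
  have hint : Integrable fun v : E d => VectorFourier.fourierPowSMulRight (scaledInner d) g v 2 :=
    VectorFourier.integrable_fourierPowSMulRight _ (hI 2 le_rfl) hg.1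
  have h3 : ∀ i : Fin d, (VectorFourier.fourierIntegral Real.fourierChar volume
      (scaledInner d).toLinearMap₁₂
      (fun v => VectorFourier.fourierPowSMulRight (scaledInner d) g v 2) x)
        ![EuclideanSpace.basisFun (Fin d) ℝ i, EuclideanSpace.basisFun (Fin d) ℝ i] =
      ∫ w : E d, Complex.exp (Complex.I * (⟪w, x⟫_ℝ : ℝ)) * (-((w i ^ 2 : ℝ) : ℂ) * g w) := by
    intro i
    unfold VectorFourier.fourierIntegral
    rw [ContinuousMultilinearMap.integral_apply]
    · refine integral_congr_ae (Eventually.of_forall fun w => ?_)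
      have hb : ⟪w, EuclideanSpace.basisFun (Fin d) ℝ i⟫_ℝ = w i := by
        rw [EuclideanSpace.inner_basisFun_real]
      simp only [scaledInner_toLinearMap_apply, Circle.smul_def, smul_apply,
        VectorFourier.fourierPowSMulRight_apply, Fin.prod_univ_two, scaledInner_apply,
        Real.fourierChar_apply, smul_eq_mul, Matrix.cons_val_zero, Matrix.cons_val_one,
        Complex.real_smul, hb]
      have e1 : ((2 * Real.pi * -(-(2 * Real.pi)⁻¹ * ⟪w, x⟫_ℝ) : ℝ) : ℂ) * Complex.I =
          Complex.I * (⟪w, x⟫_ℝ : ℝ) := by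
        push_cast
        field_simp
      rw [e1]
      congr 1
      push_cast
      field_simp
      rw [Complex.I_sq]
      ring
    · exact (VectorFourier.fourierIntegral_convergent_iff Real.continuous_fourierChar
        (by apply (scaledInner d).continuous₂) x).2 hint
  change _ • _ = _
  rw [← Finset.sum_congr rfl fun i _ => (h3 i).symm]
  rw [← integral_finsetSum]
  · simp only [invF, smul_eq_mul]
    rw [← mul_neg, ← integral_neg]
    congr 1
    refine integral_congr_ae (Eventually.of_forall fun w => ?_)
    simp only
    rw [← Finset.mul_sum, ← Finset.sum_mul, EuclideanSpace.norm_sq_eq]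
    push_cast
    simp only [Finset.sum_neg_distrib, Real.norm_eq_abs, ← Complex.ofReal_pow, sq_abs]
    ring
  · intro i _
    refine integrable_cexp_mul (hg2.mono (by have := hg.1; fun_prop)
      (Eventually.of_forall fun w => ?_)) x
    simp only [norm_mul, norm_neg, Complex.norm_real, norm_pow, norm_norm]
    gcongr
    exact PiLp.norm_apply_le w i

open scoped FourierTransform in
/-- Fourier inversion for a continuous density with integrable characteristic function. -/
lemma eq_invF_charFun {μ : Measure (E d)} [IsFiniteMeasure μ] {p : E d → ℝ} (hp : Continuous p)
    (hp0 : ∀ x, 0 ≤ p x) (hμ : μ = volume.withDensity fun x => ENNReal.ofReal (p x))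
    (hφ : Integrable (charFun μ)) (x : E d) :
    (p x : ℂ) = invF (fun w => charFun μ (-w)) x := by
  have hpint : Integrable p := by
    refine ⟨hp.aestronglyMeasurable, ?_⟩
    rw [hasFiniteIntegral_iff_ofReal (Eventually.of_forall hp0), ← setLIntegral_univ,
      ← withDensity_apply _ MeasurableSet.univ, ← hμ]
    exact measure_lt_top _ _
  -- The kernel of `𝓕` is `exp (-2πi⟪y, w⟫)`, hence the argument `-2π w`; the substitution `w ↦ 2π
  -- w` below then produces the factor `(2π)^(-d)`.
  have hF : 𝓕 (fun y => (p y : ℂ)) = fun w => charFun μ ((-(2 * Real.pi)) • w) := by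
    funext w
    rw [Real.fourier_eq', charFun_apply, hμ, integral_withDensity_eq_integral_toReal_smul
      (by fun_prop) (by simp)]
    refine integral_congr_ae (Eventually.of_forall fun y => ?_)
    simp only [ENNReal.toReal_ofReal (hp0 y), inner_smul_right, Complex.real_smul, smul_eq_mul]
    rw [mul_comm]
    push_cast
    ring_nf
  have hFint : Integrable (𝓕 (fun y => (p y : ℂ))) := by
    rw [hF]
    exact hφ.comp_smul (by simp [Real.pi_ne_zero])
  have hpC : Integrable fun y => (p y : ℂ) := hpint.ofReal
  have := hpC.fourierInv_fourier_eq hFint (v := x) (by fun_prop)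
  rw [← this, Real.fourierInv_eq', hF, invF]
  have h := Measure.integral_comp_smul (volume : Measure (E d))
    (fun w : E d => Complex.exp (Complex.I * (⟪w, x⟫_ℝ : ℝ)) * charFun μ (-w)) (2 * Real.pi)
  have h2 : |((2 * Real.pi) ^ Module.finrank ℝ (E d))⁻¹| = (2 * Real.pi)⁻¹ ^ d := by
    rw [finrank_euclideanSpace_fin, inv_pow, abs_of_pos (by positivity)]
  rw [h2, Complex.real_smul] at h
  rw [← Complex.ofReal_inv, ← Complex.ofReal_pow, ← h]
  refine integral_congr_ae (Eventually.of_forall fun w => ?_)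
  simp only [inner_smul_left, smul_eq_mul, neg_smul, conj_trivial]
  rw [mul_comm Complex.I]

/-! ### The Riesz potential as a Fourier multiplier. -/

lemma integral_rpow_mul_exp_neg_div_Ioi {a c : ℝ} (ha : 0 < a) (hc : 0 < c) :
    ∫ s in Set.Ioi (0 : ℝ), s ^ (-a - 1) * Real.exp (-c / s) = c ^ (-a) * Real.Gamma a := by
  -- The substitution `s ↦ 1/s` reduces this to Euler's integral for `Γ`.
  have h := integral_comp_rpow_Ioi (fun u : ℝ => u ^ (a - 1) * Real.exp (-(c * u)))
    (p := -1) (by norm_num)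
  rw [Real.integral_rpow_mul_exp_neg_mul_Ioi ha hc, one_div, Real.inv_rpow hc.le,
    ← Real.rpow_neg hc.le] at h
  rw [← h]
  refine setIntegral_congr_fun measurableSet_Ioi fun s (hs : 0 < s) => ?_
  simp only [smul_eq_mul, abs_neg, abs_one, one_mul]
  rw [← mul_assoc, ← Real.rpow_mul hs.le, ← Real.rpow_add hs, Real.rpow_neg_one]
  congr 2
  · ring
  · ring

lemma integrableOn_rpow_mul_exp_neg_div_Ioi {a c : ℝ} (ha : 0 < a) (hc : 0 < c) :
    IntegrableOn (fun s : ℝ => s ^ (-a - 1) * Real.exp (-c / s)) (Set.Ioi 0) := by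
  -- A Bochner integral that is not zero comes from an integrable function.
  refine Integrable.of_integral_ne_zero ?_
  rw [integral_rpow_mul_exp_neg_div_Ioi ha hc]
  have := Real.Gamma_pos_of_pos ha
  positivity

/-- Near the origin `g` is bounded and the singularity is integrable because `ν < 1 ≤ d`; outside
the unit ball the weight is at most one. -/
lemma integrable_norm_rpow_neg_mul (hd : 0 < d) {ν : ℝ} (hν0 : 0 ≤ ν) (hν : ν < 1) {g : E d → ℂ}
    (hg : Integrable g) {C : ℝ} (hC : ∀ w, ‖g w‖ ≤ C) :
    Integrable fun w : E d => ((‖w‖ ^ (-ν) : ℝ) : ℂ) * g w := by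
  have : Nonempty (Fin d) := ⟨⟨0, hd⟩⟩
  have hball : IntegrableOn (fun w : E d => ‖w‖ ^ (-ν)) (Metric.ball 0 1) := by
    rw [integrableOn_fun_norm_addHaar volume (f := fun r => r ^ (-ν))]
    have h1 : IntegrableOn (fun y : ℝ => y ^ (-ν)) (Set.Ioo 0 1) :=
      ((intervalIntegral.intervalIntegrable_rpow' (a := 0) (b := 1) (by linarith)).1).mono_set
        Set.Ioo_subset_Ioc_self
    have hm : Measurable fun y : ℝ => y ^ (Module.finrank ℝ (E d) - 1) • y ^ (-ν) := by fun_prop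
    refine Integrable.mono h1 hm.aestronglyMeasurable ?_
    filter_upwards [ae_restrict_mem measurableSet_Ioo] with y hy
    rw [norm_smul, norm_pow, Real.norm_eq_abs y, abs_of_pos hy.1]
    exact mul_le_of_le_one_left (norm_nonneg _) (pow_le_one₀ hy.1.le hy.2.le)
  have hmeas : AEStronglyMeasurable (fun w : E d => ((‖w‖ ^ (-ν) : ℝ) : ℂ) * g w) :=
    (Complex.measurable_ofReal.comp (measurable_norm.pow_const _)).aestronglyMeasurable.mul hg.1
  have hCn := (norm_nonneg _).trans (hC 0)
  rw [← integrableOn_univ, ← Set.union_compl_self (Metric.ball (0 : E d) 1)]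
  refine IntegrableOn.union ?_ ?_
  · refine (hball.mul_const C).mono' hmeas.restrict (Eventually.of_forall fun w => ?_)
    rw [norm_mul, Complex.norm_real, Real.norm_eq_abs, abs_of_nonneg (by positivity)]
    gcongr
    exact hC w
  · refine hg.norm.integrableOn.mono' hmeas.restrict ?_
    filter_upwards [ae_restrict_mem measurableSet_ball.compl] with w hw
    have hw1 : 1 ≤ ‖w‖ := by simpa using hw
    rw [norm_mul, Complex.norm_real, Real.norm_eq_abs, abs_of_nonneg (by positivity)]
    exact mul_le_of_le_one_left (norm_nonneg _)
      (Real.rpow_le_one_of_one_le_of_nonpos hw1 (by linarith))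

/-- A Gaussian average of the characteristic function is a Gaussian integral of the law. -/
lemma integral_gaussian_mul_charFun (μ : Measure (E d)) [IsFiniteMeasure μ] (x : E d) {s : ℝ}
    (hs : 0 < s) :
    ∫ w : E d, ((Real.exp (-‖w‖ ^ 2 / (4 * s)) : ℝ) : ℂ) *
        (Complex.exp (Complex.I * (⟪w, x⟫_ℝ : ℝ)) * charFun μ (-w)) =
      (((4 * Real.pi * s) ^ ((d : ℝ) / 2) * ∫ y, Real.exp (-(s * ‖x - y‖ ^ 2)) ∂μ : ℝ) : ℂ) := by
  have hb : 0 < (((4 * s)⁻¹ : ℝ) : ℂ).re := by rw [Complex.ofReal_re]; positivity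
  have hsC : (s : ℂ) ≠ 0 := by exact_mod_cast hs.ne'
  have h1 : ∀ w : E d, ((Real.exp (-‖w‖ ^ 2 / (4 * s)) : ℝ) : ℂ) *
      (Complex.exp (Complex.I * (⟪w, x⟫_ℝ : ℝ)) * charFun μ (-w)) =
      ∫ y, Complex.exp (-(((4 * s)⁻¹ : ℝ) : ℂ) * ‖w‖ ^ 2 + Complex.I * (⟪x - y, w⟫_ℝ : ℝ)) ∂μ := by
    intro w
    rw [charFun_apply, ← integral_const_mul, ← integral_const_mul]
    refine integral_congr_ae (Eventually.of_forall fun y => ?_)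
    simp only
    rw [Complex.ofReal_exp, ← Complex.exp_add, ← Complex.exp_add, inner_neg_right, inner_sub_left,
      real_inner_comm x w]
    congr 1
    push_cast
    field_simp
    ring
  simp_rw [h1]
  -- The modulus of the integrand is `exp (-‖w‖²/(4s))` and `μ` is finite, so Fubini applies; the
  -- inner integral is then the Fourier transform of a Gaussian.
  rw [integral_integral_swap]
  · have h2 : ∀ y : E d, ∫ w : E d, Complex.exp (-(((4 * s)⁻¹ : ℝ) : ℂ) * ‖w‖ ^ 2 +
        Complex.I * (⟪x - y, w⟫_ℝ : ℝ)) =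
        (((4 * Real.pi * s) ^ ((d : ℝ) / 2) * Real.exp (-(s * ‖x - y‖ ^ 2)) : ℝ) : ℂ) := by
      intro y
      rw [GaussianFourier.integral_cexp_neg_mul_sq_norm_add hb, finrank_euclideanSpace_fin,
        Complex.ofReal_mul, Complex.ofReal_cpow (by positivity), Complex.ofReal_exp, Complex.I_sq]
      push_cast
      congr 2
      · field_simp
      · field_simp
    simp_rw [h2]
    rw [integral_complex_ofReal, integral_const_mul]
  · have hG := GaussianFourier.integrable_cexp_neg_mul_sq_norm_add hb 0 (0 : E d)
    refine (hG.norm.comp_fst μ).mono' (by fun_prop) (Eventually.of_forall fun z => ?_)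
    simp [Function.uncurry, Complex.norm_exp]

/-- The Riesz kernel averaged against a law, in terms of its characteristic function. -/
lemma integrable_rieszKernel_and_integral_eq (hd : 0 < d) {ν : ℝ} (hν0 : 0 < ν) (hν : ν < 1)
    (μ : Measure (E d)) [IsFiniteMeasure μ] [NullSingletonClass μ]
    (hφ : Integrable fun w : E d => ((‖w‖ ^ (-ν) : ℝ) : ℂ) * charFun μ (-w)) (x : E d) :
    Integrable (fun y => ‖x - y‖ ^ (-(d : ℝ) + ν)) μ ∧
    (((rieszConst d ν)⁻¹ * ∫ y, ‖x - y‖ ^ (-(d : ℝ) + ν) ∂μ : ℝ) : ℂ) =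
      invF (fun w => ((‖w‖ ^ (-ν) : ℝ) : ℂ) * charFun μ (-w)) x := by
  have : Nonempty (Fin d) := ⟨⟨0, hd⟩⟩
  have hd1 : (1 : ℝ) ≤ d := by exact_mod_cast hd
  -- Both powers are superpositions of Gaussians: `‖x - y‖^(-2a)` of `exp (-s‖x - y‖²)` with weight
  -- `s^(a-1)`, and `‖w‖^(-2b)` of `exp (-‖w‖²/(4s))` with weight `s^(-b-1)`. The Gaussian transform
  -- contributes `s^(d/2)`, so the weights match because `a + b = d/2`.
  set a : ℝ := ((d : ℝ) - ν) / 2 with ha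
  have ha0 : 0 < a := by rw [ha]; linarith
  set b : ℝ := ν / 2 with hb
  have hb0 : 0 < b := by rw [hb]; linarith
  have hab : a + b = d / 2 := by rw [ha, hb]; ring
  have hΓa := Real.Gamma_pos_of_pos ha0
  have hΓb := Real.Gamma_pos_of_pos hb0
  -- the two kernels
  let G : E d → ℝ → ℝ := fun y s => s ^ (a - 1) * Real.exp (-(‖x - y‖ ^ 2 * s))
  let k : E d → ℝ → ℝ := fun w s => s ^ (-b - 1) * Real.exp (-(‖w‖ ^ 2 / 4) / s)
  let u : E d → ℂ := fun w => Complex.exp (Complex.I * (⟪w, x⟫_ℝ : ℝ)) * charFun μ (-w)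
  have hu : Measurable u := by
    have : Measurable fun w : E d => charFun μ (-w) := measurable_charFun.comp measurable_neg
    fun_prop
  have hw0 : ∀ᵐ w : E d, w ≠ 0 := by
    simp [ae_iff, measure_singleton]
  have hkint : ∀ w : E d, w ≠ 0 → ∫ s in Set.Ioi (0 : ℝ), k w s =
      (2 ^ ν * Real.Gamma b) * ‖w‖ ^ (-ν) := by
    intro w hw
    have hw' : 0 < ‖w‖ := norm_pos_iff.2 hw
    have h4 : ‖w‖ ^ 2 / 4 = (‖w‖ / 2) ^ (2 : ℝ) := by rw [Real.rpow_two]; ring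
    rw [integral_rpow_mul_exp_neg_div_Ioi hb0 (by positivity), h4, ← Real.rpow_mul (by positivity),
      show (2 : ℝ) * -b = -ν by rw [hb]; ring, Real.div_rpow hw'.le (by norm_num),
      Real.rpow_neg (by norm_num : (0 : ℝ) ≤ 2)]
    field_simp
  have hHint : Integrable (fun z : E d × ℝ => (k z.1 z.2 : ℂ) * u z.1)
      (volume.prod (volume.restrict (Set.Ioi (0 : ℝ)))) := by
    rw [integrable_prod_iff]
    · refine ⟨?_, ?_⟩
      · filter_upwards [hw0] with w hw
        have hw' : 0 < ‖w‖ := norm_pos_iff.2 hw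
        exact ((integrableOn_rpow_mul_exp_neg_div_Ioi hb0
          (c := ‖w‖ ^ 2 / 4) (by positivity)).ofReal (𝕜 := ℂ)).mul_const _
      · refine (hφ.norm.const_mul (2 ^ ν * Real.Gamma b)).congr ?_
        filter_upwards [hw0] with w hw
        have hk0 : ∀ s ∈ Set.Ioi (0 : ℝ), ‖(k w s : ℂ) * u w‖ = k w s * ‖u w‖ := by
          intro s (hs : 0 < s)
          rw [norm_mul, Complex.norm_real, Real.norm_eq_abs, abs_of_nonneg (by positivity)]
        rw [setIntegral_congr_fun measurableSet_Ioi hk0, integral_mul_const, hkint w hw, norm_mul,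
          norm_mul, norm_cexp_I_inner, Complex.norm_real, Real.norm_eq_abs,
          abs_of_nonneg (by positivity)]
        ring
    · refine Measurable.aestronglyMeasurable ?_
      fun_prop
  have hGs : ∀ s ∈ Set.Ioi (0 : ℝ), ((∫ y, G y s ∂μ : ℝ) : ℂ) =
      (((4 * Real.pi) ^ (-(d : ℝ) / 2) : ℝ) : ℂ) * ∫ w, (k w s : ℂ) * u w := by
    intro s (hs : 0 < s)
    have h1 : ∫ w, (k w s : ℂ) * u w = ((s ^ (-b - 1) : ℝ) : ℂ) *
        (((4 * Real.pi * s) ^ ((d : ℝ) / 2) * ∫ y, Real.exp (-(s * ‖x - y‖ ^ 2)) ∂μ : ℝ) : ℂ) := by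
      rw [← integral_gaussian_mul_charFun μ x hs, ← integral_const_mul]
      refine integral_congr_ae (Eventually.of_forall fun w => ?_)
      simp only [k, u]
      rw [Complex.ofReal_mul, mul_assoc, show -(‖w‖ ^ 2 / 4) / s = -‖w‖ ^ 2 / (4 * s) by
        field_simp]
    rw [h1, ← Complex.ofReal_mul, ← Complex.ofReal_mul]
    congr 1
    simp only [G]
    rw [integral_const_mul]
    simp_rw [mul_comm _ s]
    rw [← mul_assoc, ← mul_assoc]
    congr 1
    rw [Real.mul_rpow hs.le (by positivity), show -(d : ℝ) / 2 = -((d : ℝ) / 2) by ring,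
      Real.rpow_neg (by positivity), show a - 1 = (-b - 1) + (d : ℝ) / 2 by linarith,
      Real.rpow_add hs]
    have : (4 * Real.pi) ^ ((d : ℝ) / 2) ≠ 0 := by positivity
    field_simp
  -- Since `G ≥ 0` for `s > 0`, its `y`-integral is also that of its norm. By `hGs` it is a constant
  -- multiple of the `s`-marginal of the Fourier side, whose integrability is `hHint`; convergence
  -- of the Riesz integral is thus a consequence.
  have hGint : Integrable (fun z : E d × ℝ => G z.1 z.2)
      (μ.prod (volume.restrict (Set.Ioi (0 : ℝ)))) := by
    rw [integrable_prod_iff']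
    · refine ⟨?_, ?_⟩
      · filter_upwards [ae_restrict_mem measurableSet_Ioi] with s (hs : 0 < s)
        refine Integrable.const_mul ?_ _
        refine (integrable_const (1 : ℝ)).mono' (by fun_prop) (Eventually.of_forall fun y => ?_)
        rw [Real.norm_eq_abs, Real.abs_exp]
        exact Real.exp_le_one_iff.2 (neg_nonpos.2 (by positivity))
      · have h2 := (hHint.integral_prod_right.const_mul
          (((4 * Real.pi) ^ (-(d : ℝ) / 2) : ℝ) : ℂ)).re
        refine h2.congr ?_
        filter_upwards [ae_restrict_mem measurableSet_Ioi] with s (hs : 0 < s)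
        rw [← hGs s hs]
        simp only [RCLike.re_to_complex, Complex.ofReal_re]
        refine integral_congr_ae (Eventually.of_forall fun y => ?_)
        simp only [G]
        rw [Real.norm_eq_abs, abs_of_nonneg (by positivity)]
    · refine Measurable.aestronglyMeasurable ?_
      fun_prop
  -- The law has no atoms, so the singular point of the kernel is negligible.
  have hyx : ∀ᵐ y ∂μ, y ≠ x := by
    simp [ae_iff, measure_singleton]
  have hGy : ∀ᵐ y ∂μ, ∫ s in Set.Ioi (0 : ℝ), G y s =
      Real.Gamma a * ‖x - y‖ ^ (-(d : ℝ) + ν) := by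
    filter_upwards [hyx] with y hy
    have hy' : 0 < ‖x - y‖ := norm_pos_iff.2 (sub_ne_zero.2 hy.symm)
    rw [Real.integral_rpow_mul_exp_neg_mul_Ioi ha0 (by positivity), one_div,
      Real.inv_rpow (by positivity), ← Real.rpow_neg (by positivity), ← Real.rpow_two,
      ← Real.rpow_mul hy'.le, mul_comm]
    congr 2
    rw [ha]; ring
  refine ⟨?_, ?_⟩
  · have h3 := (hGint.integral_prod_left.congr hGy).const_mul (Real.Gamma a)⁻¹
    refine h3.congr (Eventually.of_forall fun y => ?_)
    simp only
    rw [inv_mul_cancel_left₀ hΓa.ne']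
  · have h4 : ((∫ y, (∫ s in Set.Ioi (0 : ℝ), G y s) ∂μ : ℝ) : ℂ) =
        (((4 * Real.pi) ^ (-(d : ℝ) / 2) : ℝ) : ℂ) *
          ∫ w, ((2 ^ ν * Real.Gamma b : ℝ) : ℂ) * (((‖w‖ ^ (-ν) : ℝ) : ℂ) * u w) := by
      rw [integral_integral_swap hGint, ← integral_complex_ofReal,
        setIntegral_congr_fun measurableSet_Ioi hGs, integral_const_mul,
        ← integral_integral_swap hHint]
      congr 1
      refine integral_congr_ae ?_
      filter_upwards [hw0] with w hw
      rw [integral_mul_const, integral_complex_ofReal, hkint w hw]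
      push_cast
      ring
    rw [integral_congr_ae hGy, integral_const_mul, integral_const_mul] at h4
    have h5 : invF (fun w => ((‖w‖ ^ (-ν) : ℝ) : ℂ) * charFun μ (-w)) x =
        (((2 * Real.pi)⁻¹ ^ d : ℝ) : ℂ) * ∫ w, ((‖w‖ ^ (-ν) : ℝ) : ℂ) * u w := by
      rw [invF]
      push_cast
      congr 1
      refine integral_congr_ae (Eventually.of_forall fun w => ?_)
      simp only [u]
      ring
    have h6 : (rieszConst d ν)⁻¹ = (Real.pi ^ ((d : ℝ) / 2) * 2 ^ ν * Real.Gamma b)⁻¹ * Real.Gamma a := by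
      rw [rieszConst, ha, hb, sub_div]
      field_simp
    rw [h5, h6, mul_assoc, Complex.ofReal_mul _ (_ * _), h4, ← mul_assoc, ← mul_assoc,
      ← Complex.ofReal_mul, ← Complex.ofReal_mul]
    congr 2
    have h7 : (2 * Real.pi) ^ d = (4 * Real.pi) ^ ((d : ℝ) / 2) * Real.pi ^ ((d : ℝ) / 2) := by
      rw [← Real.mul_rpow (by positivity) (by positivity), show 4 * Real.pi * Real.pi =
        (2 * Real.pi) ^ (2 : ℝ) by rw [Real.rpow_two]; ring, ← Real.rpow_mul (by positivity),
        ← Real.rpow_natCast]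
      congr 1
      ring
    rw [inv_pow, h7, show -(d : ℝ) / 2 = -((d : ℝ) / 2) by ring, Real.rpow_neg (by positivity)]
    field_simp

/-- The weight is at least one outside the unit ball; inside, the characteristic function is bounded
by one. -/
lemma integrable_charFun_neg_of_norm_rpow_mul {α : ℝ} (hα : 0 ≤ α) {μ : Measure (E d)}
    [IsProbabilityMeasure μ]
    (h : Integrable fun w : E d => ((‖w‖ ^ α : ℝ) : ℂ) * charFun μ (-w)) :
    Integrable fun w : E d => charFun μ (-w) := by
  have hm : Measurable fun w : E d => charFun μ (-w) := measurable_charFun.comp measurable_neg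
  rw [← integrableOn_univ, ← Set.union_compl_self (Metric.ball (0 : E d) 1)]
  refine IntegrableOn.union ?_ ?_
  · refine Integrable.mono' (g := fun _ => (1 : ℝ)) (integrableOn_const (by
      exact measure_ball_lt_top.ne)) hm.aestronglyMeasurable
      (Eventually.of_forall fun w => norm_charFun_le_one _)
  · refine h.norm.integrableOn.mono' hm.aestronglyMeasurable ?_
    filter_upwards [ae_restrict_mem measurableSet_ball.compl] with w hw
    have hw1 : 1 ≤ ‖w‖ := by simpa using hw
    rw [norm_mul, Complex.norm_real, Real.norm_eq_abs, abs_of_nonneg (by positivity)]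
    exact le_mul_of_one_le_left (norm_nonneg _) (Real.one_le_rpow hw1 hα)

lemma withDensity_ofReal_integral {p : E d → ℝ} (hp : Continuous p)
    (hp0 : ∀ x, 0 ≤ p x) (f : E d → ℝ) :
    ∫ y, f y ∂(volume.withDensity fun x => ENNReal.ofReal (p x)) = ∫ y, f y * p y := by
  rw [integral_withDensity_eq_integral_toReal_smul (by fun_prop) (by simp)]
  refine integral_congr_ae (Eventually.of_forall fun y => ?_)
  simp only [ENNReal.toReal_ofReal (hp0 y), smul_eq_mul, mul_comm]

lemma withDensity_ofReal_integrable {p : E d → ℝ} (hp : Continuous p)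
    (hp0 : ∀ x, 0 ≤ p x) (f : E d → ℝ) :
    Integrable f (volume.withDensity fun x => ENNReal.ofReal (p x)) ↔
      Integrable fun y => f y * p y := by
  rw [integrable_withDensity_iff (by fun_prop) (by simp)]
  simp only [ENNReal.toReal_ofReal (hp0 _)]

section

variable {μ : Measure (E d)} [IsProbabilityMeasure μ] {p : E d → ℝ} {α : ℝ}

/-- The case `ν = 0`, which is `α = 2`, is Fourier inversion; for `ν > 0` the kernel formula is
applied to the law with density `p`. -/
lemma rieszConverges_and_riesz_eq_invF (hd : 0 < d) {ν : ℝ} (hν0 : 0 ≤ ν) (hν : ν < 1)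
    (hp : Continuous p) (hp0 : ∀ x, 0 ≤ p x)
    (hμ : μ = volume.withDensity fun x => ENNReal.ofReal (p x))
    (hφ : Integrable fun w => charFun μ (-w)) (x : E d) :
    RieszConverges ν p x ∧
      (riesz ν p x : ℂ) = invF (fun w => ((‖w‖ ^ (-ν) : ℝ) : ℂ) * charFun μ (-w)) x := by
  have : Nonempty (Fin d) := ⟨⟨0, hd⟩⟩
  rcases hν0.eq_or_lt with rfl | hν0
  · refine ⟨fun h => absurd rfl h, ?_⟩
    have h := eq_invF_charFun hp hp0 hμ (by simpa using hφ.comp_neg) x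
    simpa [riesz] using h
  · have : NullSingletonClass μ := by
      rw [hμ]; infer_instance
    have h := integrable_rieszKernel_and_integral_eq hd hν0 hν μ
      (integrable_norm_rpow_neg_mul hd hν0.le hν hφ fun w => norm_charFun_le_one (-w)) x
    refine ⟨fun _ => ?_, ?_⟩
    · rw [← withDensity_ofReal_integrable hp hp0, ← hμ]
      exact h.1
    · rw [← h.2, riesz, if_neg hν0.ne', ← withDensity_ofReal_integral hp hp0, ← hμ]

/-- The transform of the potential has multiplier `‖w‖^(-(2-α))`. Two derivatives cost `‖w‖^2`,
which leaves exactly the integrable weight `‖w‖^α`. -/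
lemma contDiff_riesz_and_laplacian_riesz (hd : 0 < d) (hα : 1 < α) (hα2 : α ≤ 2)
    (hp : Continuous p) (hp0 : ∀ x, 0 ≤ p x)
    (hμ : μ = volume.withDensity fun x => ENNReal.ofReal (p x))
    (h : Integrable fun w : E d => ((‖w‖ ^ α : ℝ) : ℂ) * charFun μ (-w)) :
    ContDiff ℝ 2 (riesz (2 - α) p) ∧
      ∀ x, Laplacian.laplacian (riesz (2 - α) p) x = -(fracInvFourier α μ x).re := by
  have hφ := integrable_charFun_neg_of_norm_rpow_mul (by linarith) h
  have hg := integrable_norm_rpow_neg_mul hd (ν := 2 - α) (by linarith) (by linarith) hφ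
    fun w => norm_charFun_le_one (-w)
  have hmul : ∀ w : E d, ‖w‖ ^ 2 * ‖w‖ ^ (-(2 - α)) = ‖w‖ ^ α := by
    intro w
    rcases (norm_nonneg w).eq_or_lt with h0 | h0
    -- At the origin both sides vanish, whatever value the negative power takes there.
    · rw [← h0, Real.zero_rpow (x := α) (by linarith)]
      simp
    · rw [← Real.rpow_two, ← Real.rpow_add h0]
      congr 1
      ring
  have hg2 : Integrable fun w : E d =>
      ‖w‖ ^ 2 * ‖((‖w‖ ^ (-(2 - α)) : ℝ) : ℂ) * charFun μ (-w)‖ := by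
    refine h.norm.congr (Eventually.of_forall fun w => ?_)
    simp only [norm_mul, Complex.norm_real, Real.norm_eq_abs]
    rw [abs_of_nonneg (by positivity), abs_of_nonneg (by positivity), ← mul_assoc, hmul]
  have hcd := contDiff_invF hg hg2
  have hr : riesz (2 - α) p = Complex.reCLM ∘
      invF fun w : E d => ((‖w‖ ^ (-(2 - α)) : ℝ) : ℂ) * charFun μ (-w) := by
    funext x
    rw [Function.comp_apply, ← (rieszConverges_and_riesz_eq_invF hd (by linarith) (by linarith)
      hp hp0 hμ hφ x).2]
    simp
  rw [hr]
  refine ⟨Complex.reCLM.contDiff.comp hcd, fun x => ?_⟩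
  rw [hcd.contDiffAt.laplacian_CLM_comp_left, Function.comp_apply, laplacian_invF hg hg2]
  simp only [Complex.reCLM_apply, Complex.neg_re]
  congr 3
  funext w
  rw [← mul_assoc, ← Complex.ofReal_mul, hmul]

end

/-! ### Green's identity on the whole space. -/

/-- Integration in polar coordinates. -/
lemma integral_eq_integral_Ioi_integral_sphere (hd : 0 < d) {f : E d → ℝ} (hf : Integrable f) :
    ∫ x, f x = ∫ r in Set.Ioi (0 : ℝ), r ^ (d - 1) *
      ∫ s : Metric.sphere (0 : E d) 1, f (r • (s : E d)) ∂((volume : Measure (E d)).toSphere) := by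
  have : Nonempty (Fin d) := ⟨⟨0, hd⟩⟩
  have hmp := (volume : Measure (E d)).measurePreserving_homeomorphUnitSphereProd
  have hemb := (homeomorphUnitSphereProd (E d)).measurableEmbedding
  set F : Metric.sphere (0 : E d) 1 × Set.Ioi (0 : ℝ) → ℝ := fun z => f ((z.2 : ℝ) • (z.1 : E d))
  have hF : ∀ x : ({0}ᶜ : Set (E d)), F (homeomorphUnitSphereProd (E d) x) = f x := by
    intro x
    have hx : ‖(x : E d)‖ ≠ 0 := norm_ne_zero_iff.2 x.2
    simp [F, smul_smul, hx]
  have h1 : ∫ x, f x = ∫ z, F z ∂((volume : Measure (E d)).toSphere.prod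
      (.volumeIoiPow (Module.finrank ℝ (E d) - 1))) := by
    rw [← hmp.integral_comp hemb]
    simp_rw [hF]
    rw [integral_subtype_comap (measurableSet_singleton _).compl f, restrict_compl_singleton]
  have h2 : Integrable F ((volume : Measure (E d)).toSphere.prod
      (.volumeIoiPow (Module.finrank ℝ (E d) - 1))) := by
    rw [← hmp.integrable_comp_emb hemb]
    have h3 : F ∘ homeomorphUnitSphereProd (E d) = f ∘ Subtype.val := funext hF
    rw [h3, ← integrableOn_iff_comap_subtypeVal (measurableSet_singleton _).compl]
    exact hf.integrableOn
  rw [h1, integral_prod_symm _ h2, finrank_euclideanSpace_fin, Measure.volumeIoiPow]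
  simp only [ENNReal.ofReal]
  rw [integral_withDensity_eq_integral_smul (measurable_subtype_coe.pow_const _).real_toNNReal,
    integral_subtype_comap measurableSet_Ioi fun r : ℝ => Real.toNNReal (r ^ (d - 1)) •
      ∫ s : Metric.sphere (0 : E d) 1, f (r • (s : E d)) ∂((volume : Measure (E d)).toSphere)]
  refine setIntegral_congr_fun measurableSet_Ioi fun r (hr : 0 < r) => ?_
  rw [NNReal.smul_def, Real.coe_toNNReal _ (by positivity), smul_eq_mul]

/-- A smooth cutoff equal to `1` on the ball of radius `R` and to `0` outside that of radius
`2 * R`. -/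
def ballCutoff (R : ℝ) (x : E d) : ℝ := Real.smoothTransition (2 - ‖x‖ ^ 2 / R ^ 2)

/-- `ballCutoffSlope R r * r` is minus the radial derivative of `ballCutoff R` at distance `r`. -/
def ballCutoffSlope (R r : ℝ) : ℝ := deriv Real.smoothTransition (2 - r ^ 2 / R ^ 2) * (2 / R ^ 2)

lemma contDiff_ballCutoff (R : ℝ) : ContDiff ℝ 1 (ballCutoff R : E d → ℝ) :=
  Real.smoothTransition.contDiff.comp
    (contDiff_const.sub ((contDiff_norm_sq ℝ).div_const _))

lemma fderiv_ballCutoff (R : ℝ) (x v : E d) :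
    fderiv ℝ (ballCutoff R) x v = -(ballCutoffSlope R ‖x‖ * ⟪x, v⟫_ℝ) := by
  have h1 : HasDerivAt Real.smoothTransition
      (deriv Real.smoothTransition (2 - ‖x‖ ^ 2 / R ^ 2)) (2 - ‖x‖ ^ 2 / R ^ 2) :=
    ((Real.smoothTransition.contDiff (n := 1)).differentiable (by simp) _).hasDerivAt
  have h2 := ((hasStrictFDerivAt_norm_sq x).hasFDerivAt.mul_const ((R ^ 2)⁻¹)).const_sub (2 : ℝ)
  have h3 : HasFDerivAt (ballCutoff R : E d → ℝ) _ x := h1.comp_hasFDerivAt x h2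
  rw [h3.fderiv]
  simp [ballCutoffSlope, innerSL_apply_apply]
  ring

lemma ballCutoff_eq_one {R : ℝ} (hR : 0 < R) {x : E d} (hx : ‖x‖ ≤ R) : ballCutoff R x = 1 := by
  refine Real.smoothTransition.one_of_one_le ?_
  have : ‖x‖ ^ 2 / R ^ 2 ≤ 1 := by
    rw [div_le_one (by positivity)]
    gcongr
  linarith

lemma ballCutoff_eq_zero {R : ℝ} (hR : 0 < R) {x : E d} (hx : 2 * R ≤ ‖x‖) :
    ballCutoff R x = 0 := by
  refine Real.smoothTransition.zero_of_nonpos ?_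
  have : 2 ≤ ‖x‖ ^ 2 / R ^ 2 := by
    rw [le_div_iff₀ (by positivity)]
    nlinarith
  linarith

lemma abs_ballCutoff_le_one (R : ℝ) (x : E d) : |ballCutoff R x| ≤ 1 := by
  rw [ballCutoff, abs_of_nonneg (Real.smoothTransition.nonneg _)]
  exact Real.smoothTransition.le_one _

lemma hasCompactSupport_ballCutoff {R : ℝ} (hR : 0 < R) :
    HasCompactSupport (ballCutoff R : E d → ℝ) := by
  refine HasCompactSupport.intro (isCompact_closedBall (0 : E d) (2 * R)) fun x hx => ?_
  refine ballCutoff_eq_zero hR ?_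
  simp only [Metric.mem_closedBall, dist_zero_right, not_le] at hx
  exact hx.le

lemma deriv_smoothTransition_eq_zero {x : ℝ} (hx : x < 0 ∨ 1 < x) :
    deriv Real.smoothTransition x = 0 := by
  rcases hx with hx | hx
  · have : Real.smoothTransition =ᶠ[𝓝 x] fun _ => 0 := by
      filter_upwards [Iio_mem_nhds hx] with y hy using Real.smoothTransition.zero_of_nonpos hy.le
    rw [this.deriv_eq, deriv_const]
  · have : Real.smoothTransition =ᶠ[𝓝 x] fun _ => 1 := by
      filter_upwards [Ioi_mem_nhds hx] with y hy using Real.smoothTransition.one_of_one_le hy.le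
    rw [this.deriv_eq, deriv_const]

lemma continuous_deriv_smoothTransition : Continuous (deriv Real.smoothTransition) :=
  (Real.smoothTransition.contDiff (n := 1)).continuous_deriv le_rfl

lemma exists_abs_deriv_smoothTransition_le : ∃ M, ∀ x, |deriv Real.smoothTransition x| ≤ M := by
  have h : HasCompactSupport (deriv Real.smoothTransition) := by
    refine HasCompactSupport.intro (isCompact_Icc (a := (0 : ℝ)) (b := 1)) fun x hx => ?_
    refine deriv_smoothTransition_eq_zero ?_
    rw [Set.mem_Icc] at hx
    by_contra! h'
    exact hx h'
  obtain ⟨M, hM⟩ := continuous_deriv_smoothTransition.bounded_above_of_compact_support h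
  exact ⟨M, hM⟩

lemma ballCutoffSlope_eq_zero {R r : ℝ} (hR : 0 < R) (hr : 0 ≤ r) (h : r < R ∨ 2 * R < r) :
    ballCutoffSlope R r = 0 := by
  rw [ballCutoffSlope, deriv_smoothTransition_eq_zero, zero_mul]
  rcases h with h | h
  · right
    have : r ^ 2 / R ^ 2 < 1 := by
      rw [div_lt_one (by positivity)]
      gcongr
    linarith
  · left
    have : 2 < r ^ 2 / R ^ 2 := by
      rw [lt_div_iff₀ (by positivity)]
      nlinarith
    linarith

lemma continuous_ballCutoffSlope (R : ℝ) : Continuous (ballCutoffSlope R) :=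
  (continuous_deriv_smoothTransition.comp (by fun_prop)).mul_const _

lemma integrable_ballCutoffSlope_mul_inner {V : E d → E d} (hV : Continuous V) {R : ℝ}
    (hR : 0 < R) : Integrable fun x => ballCutoffSlope R ‖x‖ * ⟪V x, x⟫_ℝ := by
  refine Continuous.integrable_of_hasCompactSupport
    (((continuous_ballCutoffSlope R).comp continuous_norm).mul (hV.inner continuous_id)) ?_
  refine HasCompactSupport.intro (isCompact_closedBall (0 : E d) (2 * R)) fun x hx => ?_
  simp only [Metric.mem_closedBall, dist_zero_right, not_le] at hx
  rw [ballCutoffSlope_eq_zero hR (norm_nonneg x) (Or.inr hx), zero_mul]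

/-- In polar coordinates the error term of the cutoff becomes a radially weighted average of the
fluxes through spheres. -/
lemma integral_ballCutoffSlope_mul_inner (hd : 0 < d) {V : E d → E d} (hV : Continuous V) {R : ℝ}
    (hR : 0 < R) :
    ∫ x, ballCutoffSlope R ‖x‖ * ⟪V x, x⟫_ℝ =
      ∫ r in Set.Ioi (0 : ℝ), ballCutoffSlope R r * r * sphereFlux V r := by
  rw [integral_eq_integral_Ioi_integral_sphere hd
    (integrable_ballCutoffSlope_mul_inner hV hR)]
  refine setIntegral_congr_fun measurableSet_Ioi fun r (hr : 0 < r) => ?_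
  simp only [sphereFlux]
  have : ∀ s : Metric.sphere (0 : E d) 1, ballCutoffSlope R ‖r • (s : E d)‖ *
      ⟪V (r • (s : E d)), r • (s : E d)⟫_ℝ =
      (ballCutoffSlope R r * r) * ⟪V (r • (s : E d)), (s : E d)⟫_ℝ := by
    intro s
    rw [norm_smul, norm_eq_of_mem_sphere, inner_smul_right, Real.norm_eq_abs, abs_of_pos hr]
    ring_nf
  simp_rw [this]
  rw [integral_const_mul]
  ring

/-- With `M` a bound for the derivative of the transition function, the weight is at most
`(2M/R²)(2R) = 4M/R` in modulus and lives on `[R, 2R]`. Its total mass is at most `4M` for every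
`R`, so fluxes tending to zero force the average to zero. -/
lemma tendsto_integral_ballCutoffSlope_mul_inner (hd : 0 < d) {V : E d → E d} (hV : Continuous V)
    (hflux : Tendsto (sphereFlux V) atTop (𝓝 0)) :
    Tendsto (fun R : ℝ => ∫ x, ballCutoffSlope R ‖x‖ * ⟪V x, x⟫_ℝ) atTop (𝓝 0) := by
  obtain ⟨M, hM⟩ := exists_abs_deriv_smoothTransition_le
  have hM0 : 0 ≤ M := (abs_nonneg _).trans (hM 0)
  rw [Metric.tendsto_atTop] at hflux ⊢
  intro ε hε
  -- The `+ 1` keeps the denominator positive when `M = 0` and makes the final inequality strict.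
  obtain ⟨R₀, hR₀⟩ := hflux (ε / (4 * M + 1)) (by positivity)
  refine ⟨max R₀ 1, fun R hR => ?_⟩
  have hR1 : 0 < R := zero_lt_one.trans_le ((le_max_right _ _).trans hR)
  have hR2 : R₀ ≤ R := (le_max_left _ _).trans hR
  rw [dist_zero_right, integral_ballCutoffSlope_mul_inner hd hV hR1,
    setIntegral_eq_of_subset_of_forall_sdiff_eq_zero (s := Set.Icc R (2 * R)) measurableSet_Ioi
      (fun r hr => hR1.trans_le hr.1)]
  · have hb : ∀ r ∈ Set.Icc R (2 * R), ‖ballCutoffSlope R r * r * sphereFlux V r‖ ≤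
        (M * (2 / R ^ 2)) * (2 * R) * (ε / (4 * M + 1)) := by
      intro r hr
      have hr0 : 0 < r := hR1.trans_le hr.1
      have h1 := (hR₀ r (hR2.trans hr.1)).le
      rw [dist_zero_right] at h1
      rw [norm_mul, norm_mul, ballCutoffSlope, norm_mul, Real.norm_eq_abs r, abs_of_pos hr0,
        Real.norm_eq_abs (2 / R ^ 2), abs_of_pos (show 0 < 2 / R ^ 2 by positivity)]
      gcongr
      · exact hM _
      · exact hr.2
    have h2 := norm_setIntegral_le_of_norm_le_const (μ := volume) measure_Icc_lt_top hb
    refine h2.trans_lt ?_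
    rw [Measure.real, Real.volume_Icc, ENNReal.toReal_ofReal (by linarith)]
    have : M * (2 / R ^ 2) * (2 * R) * (ε / (4 * M + 1)) * (2 * R - R) =
        ε * (4 * M / (4 * M + 1)) := by
      field_simp
      ring
    rw [this]
    refine mul_lt_of_lt_one_right hε ?_
    rw [div_lt_one (by positivity)]
    linarith
  · intro r hr
    have hr0 : 0 < r := hr.1
    have : r < R ∨ 2 * R < r := by
      by_contra! h
      exact hr.2 h
    rw [ballCutoffSlope_eq_zero hR1 hr0.le this, zero_mul, zero_mul]

lemma inner_gradient_eq_fderiv (g : E d → ℝ) (x v : E d) : ⟪∇ g x, v⟫_ℝ = fderiv ℝ g x v := by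
  rw [gradient, InnerProductSpace.toDual_symm_apply]

lemma continuous_gradient {g : E d → ℝ} (hg : ContDiff ℝ 1 g) : Continuous (∇ g) :=
  (InnerProductSpace.toDual ℝ (E d)).symm.continuous.comp (hg.continuous_fderiv (by simp))

lemma laplacian_eq_sum_fderiv {g : E d → ℝ} (hg : ContDiff ℝ 2 g) (x : E d) :
    Laplacian.laplacian g x = ∑ i, fderiv ℝ
      (fun y => fderiv ℝ g y (EuclideanSpace.basisFun (Fin d) ℝ i)) x
        (EuclideanSpace.basisFun (Fin d) ℝ i) := by
  rw [InnerProductSpace.laplacian_eq_iteratedFDeriv_orthonormalBasis _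
      (EuclideanSpace.basisFun (Fin d) ℝ)]
  refine Finset.sum_congr rfl fun i _ => ?_
  have h : DifferentiableAt ℝ (fderiv ℝ g) x :=
    (hg.fderiv_right (m := 1) (by norm_num)).differentiable (by simp) x
  rw [iteratedFDeriv_two_apply, fderiv_clm_apply h (differentiableAt_const _)]
  simp

lemma continuous_laplacian {g : E d → ℝ} (hg : ContDiff ℝ 2 g) :
    Continuous (Laplacian.laplacian g) := by
  have : Laplacian.laplacian g = fun x => ∑ i, fderiv ℝ
      (fun y => fderiv ℝ g y (EuclideanSpace.basisFun (Fin d) ℝ i)) x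
        (EuclideanSpace.basisFun (Fin d) ℝ i) := funext fun x => laplacian_eq_sum_fderiv hg x
  rw [this]
  refine continuous_finsetSum _ fun i _ => ?_
  have h1 : ContDiff ℝ 1 fun y => fderiv ℝ g y (EuclideanSpace.basisFun (Fin d) ℝ i) :=
    (hg.fderiv_right (m := 1) (by norm_num)).clm_apply contDiff_const
  exact (h1.continuous_fderiv (by simp)).clm_apply continuous_const

/-- Green's second identity with a smooth cutoff. -/
lemma integral_ballCutoff_mul_green {f g : E d → ℝ} (hf : ContDiff ℝ 2 f) (hg : ContDiff ℝ 2 g)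
    {R : ℝ} (hR : 0 < R) :
    ∫ x, ballCutoff R x * (f x * Laplacian.laplacian g x - g x * Laplacian.laplacian f x) =
      ∫ x, ballCutoffSlope R ‖x‖ * ⟪f x • ∇ g x - g x • ∇ f x, x⟫_ℝ := by
  set e := EuclideanSpace.basisFun (Fin d) ℝ with he
  have hf1 : ∀ i, ContDiff ℝ 1 fun y => fderiv ℝ f y (e i) := fun i =>
    (hf.fderiv_right (m := 1) (by norm_num)).clm_apply contDiff_const
  have hg1 : ∀ i, ContDiff ℝ 1 fun y => fderiv ℝ g y (e i) := fun i =>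
    (hg.fderiv_right (m := 1) (by norm_num)).clm_apply contDiff_const
  have hf0 : ContDiff ℝ 1 f := hf.of_le (by norm_num)
  have hg0 : ContDiff ℝ 1 g := hg.of_le (by norm_num)
  -- The components of `f ∇g - g ∇f`; in the divergence the products of first derivatives cancel.
  let h : Fin d → E d → ℝ := fun i y => f y * fderiv ℝ g y (e i) - g y * fderiv ℝ f y (e i)
  have hh : ∀ i, ContDiff ℝ 1 (h i) := fun i => (hf0.mul (hg1 i)).sub (hg0.mul (hf1 i))
  have hhd : ∀ i x, fderiv ℝ (h i) x (e i) =
      f x * fderiv ℝ (fun y => fderiv ℝ g y (e i)) x (e i) -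
        g x * fderiv ℝ (fun y => fderiv ℝ f y (e i)) x (e i) := by
    intro i x
    have df := (hf0.differentiable (by simp) x)
    have dg := (hg0.differentiable (by simp) x)
    have df1 := ((hf1 i).differentiable (by simp) x)
    have dg1 := ((hg1 i).differentiable (by simp) x)
    simp only [h]
    rw [fderiv_fun_sub (df.fun_mul dg1) (dg.fun_mul df1), fderiv_fun_mul df dg1, fderiv_fun_mul dg df1]
    simp
    ring
  have hχ := contDiff_ballCutoff (d := d) R
  have hχc := hasCompactSupport_ballCutoff (d := d) hR
  have hi1 : ∀ i, Integrable fun x => ballCutoff R x * fderiv ℝ (h i) x (e i) := fun i =>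
    (hχ.continuous.mul (((hh i).continuous_fderiv (by simp)).clm_apply
      continuous_const)).integrable_of_hasCompactSupport hχc.mul_right
  have hi2 : ∀ i, Integrable fun x => fderiv ℝ (ballCutoff R) x (e i) * h i x := fun i =>
    (((hχ.continuous_fderiv (by simp)).clm_apply
      continuous_const).mul (hh i).continuous).integrable_of_hasCompactSupport
        (hχc.fderiv_apply (𝕜 := ℝ) (e i)).mul_right
  have hi3 : ∀ i, Integrable fun x => ballCutoff R x * h i x := fun i =>
    (hχ.continuous.mul (hh i).continuous).integrable_of_hasCompactSupport hχc.mul_right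
  -- Integration by parts has no boundary term here, as the cutoff has compact support.
  have hparts : ∀ i, ∫ x, ballCutoff R x * fderiv ℝ (h i) x (e i) =
      -∫ x, fderiv ℝ (ballCutoff R) x (e i) * h i x := fun i =>
    integral_mul_fderiv_eq_neg_fderiv_mul_of_integrable (hi2 i) (hi1 i) (hi3 i)
      (fun x _ => hχ.differentiable (by simp) x) (fun x _ => (hh i).differentiable (by simp) x)
  calc ∫ x, ballCutoff R x * (f x * Laplacian.laplacian g x - g x * Laplacian.laplacian f x)
      = ∫ x, ∑ i, ballCutoff R x * fderiv ℝ (h i) x (e i) := by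
        refine integral_congr_ae (Eventually.of_forall fun x => ?_)
        simp only [hhd]
        rw [← Finset.mul_sum, Finset.sum_sub_distrib, ← Finset.mul_sum, ← Finset.mul_sum,
          laplacian_eq_sum_fderiv hf, laplacian_eq_sum_fderiv hg]
    _ = ∫ x, -∑ i, fderiv ℝ (ballCutoff R) x (e i) * h i x := by
        rw [integral_finsetSum _ fun i _ => hi1 i, Finset.sum_congr rfl fun i _ => hparts i,
          integral_neg, integral_finsetSum _ fun i _ => hi2 i, Finset.sum_neg_distrib]
    _ = _ := by
        refine integral_congr_ae (Eventually.of_forall fun x => ?_)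
        have hsum : ∀ φ : E d → ℝ, ∑ i, ⟪x, e i⟫_ℝ * fderiv ℝ φ x (e i) = fderiv ℝ φ x x := by
          intro φ
          conv_rhs => rw [← e.sum_repr' x, map_sum]
          refine Finset.sum_congr rfl fun i _ => ?_
          rw [map_smul, smul_eq_mul, real_inner_comm, e.sum_repr' x]
        simp only [fderiv_ballCutoff, h]
        rw [inner_sub_left, inner_smul_left, inner_smul_left, inner_gradient_eq_fderiv,
          inner_gradient_eq_fderiv, ← hsum f, ← hsum g, ← Finset.sum_neg_distrib]
        simp only [conj_trivial, Finset.mul_sum, ← Finset.sum_sub_distrib]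
        refine Finset.sum_congr rfl fun i _ => ?_
        ring

/-- Green's second identity on the whole space, when the boundary terms vanish at infinity. -/
lemma integral_mul_laplacian_comm (hd : 0 < d) {f g : E d → ℝ} (hf : ContDiff ℝ 2 f)
    (hg : ContDiff ℝ 2 g)
    (hflux₁ : Tendsto (sphereFlux fun y => f y • ∇ g y) atTop (𝓝 0))
    (hflux₂ : Tendsto (sphereFlux fun y => g y • ∇ f y) atTop (𝓝 0))
    (hint₁ : Integrable fun x => f x * Laplacian.laplacian g x)
    (hint₂ : Integrable fun x => g x * Laplacian.laplacian f x) :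
    ∫ x, f x * Laplacian.laplacian g x = ∫ x, g x * Laplacian.laplacian f x := by
  have hV₁ : Continuous fun y => f y • ∇ g y :=
    hf.continuous.smul (continuous_gradient (hg.of_le (by norm_num)))
  have hV₂ : Continuous fun y => g y • ∇ f y :=
    hg.continuous.smul (continuous_gradient (hf.of_le (by norm_num)))
  have hint := hint₁.sub hint₂
  have hsl : ∀ {V : E d → E d}, Continuous V → ∀ {R : ℝ}, 0 < R →
      Integrable fun x => ballCutoffSlope R ‖x‖ * ⟪V x, x⟫_ℝ := fun hV R hR =>
    integrable_ballCutoffSlope_mul_inner hV hR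
  have h1 : Tendsto (fun R : ℝ => ∫ x, ballCutoff R x *
      (f x * Laplacian.laplacian g x - g x * Laplacian.laplacian f x)) atTop (𝓝 0) := by
    have h2 := (tendsto_integral_ballCutoffSlope_mul_inner hd hV₁ hflux₁).sub
      (tendsto_integral_ballCutoffSlope_mul_inner hd hV₂ hflux₂)
    rw [sub_zero] at h2
    refine h2.congr' ?_
    filter_upwards [eventually_gt_atTop 0] with R hR
    rw [integral_ballCutoff_mul_green hf hg hR, ← integral_sub (hsl hV₁ hR) (hsl hV₂ hR)]
    refine integral_congr_ae (Eventually.of_forall fun x => ?_)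
    simp only [inner_sub_left, mul_sub]
  -- The same cutoff integrals also converge to the full integral by dominated convergence, so that
  -- integral is zero.
  have h3 : Tendsto (fun R : ℝ => ∫ x, ballCutoff R x *
      (f x * Laplacian.laplacian g x - g x * Laplacian.laplacian f x)) atTop
      (𝓝 (∫ x, (f x * Laplacian.laplacian g x - g x * Laplacian.laplacian f x))) := by
    refine tendsto_integral_filter_of_dominated_convergence _ (Eventually.of_forall fun R => ?_)
      (Eventually.of_forall fun R => Eventually.of_forall fun x => ?_) hint.norm
      (Eventually.of_forall fun x => ?_)
    · exact (contDiff_ballCutoff R).continuous.aestronglyMeasurable.mul hint.1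
    · rw [norm_mul, Real.norm_eq_abs (ballCutoff R x)]
      exact mul_le_of_le_one_left (norm_nonneg _) (abs_ballCutoff_le_one R x)
    · refine tendsto_const_nhds.congr' ?_
      filter_upwards [eventually_ge_atTop ‖x‖, eventually_gt_atTop 0] with R hR hR0
      rw [ballCutoff_eq_one hR0 hR, one_mul]
  have h4 := tendsto_nhds_unique h3 h1
  rw [integral_sub hint₁ hint₂] at h4
  linarith

/-! ### Densities and convolution. -/

lemma density_eq_of_continuous {μ : Measure (E d)} {p : E d → ℝ} (hp : Continuous p)
    (hp0 : ∀ x, 0 ≤ p x) (hμ : μ = volume.withDensity fun x => ENNReal.ofReal (p x)) :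
    density μ = p := by
  have h : ∃ p : E d → ℝ, Continuous p ∧ (∀ x, 0 ≤ p x) ∧
      μ = volume.withDensity (fun x => ENNReal.ofReal (p x)) := ⟨p, hp, hp0, hμ⟩
  rw [density, dif_pos h]
  obtain ⟨h1, h2, h3⟩ := h.choose_spec
  set q := h.choose
  have h4 : (fun x => ENNReal.ofReal (q x)) =ᵐ[volume] fun x => ENNReal.ofReal (p x) := by
    rw [← withDensity_eq_iff_of_sigmaFinite (by fun_prop) (by fun_prop), ← h3, ← hμ]
  -- Continuous functions that agree Lebesgue-almost everywhere are equal, so the chosen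
  -- representative is `p`.
  rw [← h1.ae_eq_iff_eq volume hp]
  filter_upwards [h4] with x hx
  rwa [ENNReal.ofReal_eq_ofReal_iff (h2 x) (hp0 x)] at hx

/-- The convolution of a function with a measure. -/
def smoothed (p : E d → ℝ) (ν : Measure (E d)) (x : E d) : ℝ := ∫ z, p (x - z) ∂ν

section

variable {p : E d → ℝ} {ν : Measure (E d)} [IsProbabilityMeasure ν]

lemma integrable_comp_sub_of_bounded (hp : Continuous p) {C : ℝ} (hC : ∀ x, |p x| ≤ C) (x : E d) :
    Integrable (fun z => p (x - z)) ν :=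
  (integrable_const C).mono' (by fun_prop) (Eventually.of_forall fun z => hC _)

lemma continuous_smoothed (hp : Continuous p) {C : ℝ} (hC : ∀ x, |p x| ≤ C) :
    Continuous (smoothed p ν) :=
  continuous_of_dominated (bound := fun _ => C) (fun x => by fun_prop)
    (fun x => Eventually.of_forall fun z => hC _) (integrable_const C)
    (Eventually.of_forall fun z => by fun_prop)

lemma smoothed_pos (hp : Continuous p) {C : ℝ} (hC : ∀ x, |p x| ≤ C) (hpos : ∀ x, 0 < p x)
    (x : E d) : 0 < smoothed p ν x := by
  rw [smoothed, integral_pos_iff_support_of_nonneg (fun z => (hpos _).le)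
    (integrable_comp_sub_of_bounded hp hC x)]
  have : Function.support (fun z => p (x - z)) = Set.univ :=
    Set.eq_univ_of_forall fun z => (hpos _).ne'
  rw [this]
  simp

/-- Tonelli together with translation invariance of Lebesgue measure; boundedness of `p` makes the
real convolution integral agree with the extended one. -/
lemma conv_eq_withDensity_smoothed (hp : Continuous p) {C : ℝ} (hC : ∀ x, |p x| ≤ C)
    (hpos : ∀ x, 0 < p x) :
    ν ∗ (volume.withDensity fun x => ENNReal.ofReal (p x)) =
      volume.withDensity fun x => ENNReal.ofReal (smoothed p ν x) := by
  ext s hs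
  have hms : Measurable (s.indicator (1 : E d → ENNReal)) := measurable_one.indicator hs
  rw [withDensity_apply _ hs, ← lintegral_indicator_one hs, Measure.lintegral_conv hms]
  have h1 : ∀ z, ∫⁻ y, s.indicator 1 (z + y) ∂(volume.withDensity fun x => ENNReal.ofReal (p x)) =
      ∫⁻ x, ENNReal.ofReal (p (x - z)) * s.indicator 1 x := by
    intro z
    rw [lintegral_withDensity_eq_lintegral_mul _ (by fun_prop) (by fun_prop),
      ← lintegral_sub_right_eq_self _ z]
    simp
  simp_rw [h1]
  rw [lintegral_lintegral_swap (by fun_prop), ← lintegral_indicator hs]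
  refine lintegral_congr fun x => ?_
  rw [lintegral_mul_const _ (by fun_prop), ← ofReal_integral_eq_lintegral_ofReal
    (integrable_comp_sub_of_bounded hp hC x) (Eventually.of_forall fun z => (hpos _).le)]
  by_cases hx : x ∈ s <;> simp [hx, smoothed]

end

/-! ### The stable flow and the derivative of the entropy. -/

lemma exists_norm_invF_le (g : E d → ℂ) : ∃ C, ∀ x, ‖invF g x‖ ≤ C := by
  refine ⟨‖((2 * Real.pi : ℝ) : ℂ)⁻¹ ^ d‖ * ∫ w, ‖g w‖, fun x => ?_⟩
  rw [invF, norm_mul]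
  gcongr
  refine (norm_integral_le_integral_norm _).trans_eq ?_
  simp

/-- The heat-type semigroup of the stable laws on the Fourier side. -/
def stableFlow (α : ℝ) (φ : E d → ℂ) (x : E d) (s : ℝ) : ℂ :=
  invF (fun w => φ w * ((Real.exp (-(s * ‖w‖ ^ α / α)) : ℝ) : ℂ)) x

lemma norm_mul_exp_neg_le {α : ℝ} (hα : 0 < α) (z : ℂ) {s : ℝ} (hs : 0 ≤ s) (w : E d) :
    ‖z * ((Real.exp (-(s * ‖w‖ ^ α / α)) : ℝ) : ℂ)‖ ≤ ‖z‖ := by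
  rw [norm_mul, Complex.norm_real, Real.norm_eq_abs, Real.abs_exp]
  exact mul_le_of_le_one_right (norm_nonneg _) (Real.exp_le_one_iff.2 (neg_nonpos.2 (by positivity)))

lemma continuousOn_stableFlow {α : ℝ} (hα : 0 < α) {φ : E d → ℂ} (hφ : Integrable φ) (x : E d) :
    ContinuousOn (stableFlow α φ x) (Set.Ici 0) := by
  refine continuousOn_const.mul (continuousOn_of_dominated (bound := fun w => ‖φ w‖)
    (fun s _ => ?_) (fun s (hs : 0 ≤ s) => Eventually.of_forall fun w => ?_) hφ.norm
    (Eventually.of_forall fun w => by fun_prop))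
  · have hm : Measurable fun w : E d => ((Real.exp (-(s * ‖w‖ ^ α / α)) : ℝ) : ℂ) := by fun_prop
    have he : AEStronglyMeasurable fun w : E d => Complex.exp (Complex.I * (⟪w, x⟫_ℝ : ℝ)) := by
      fun_prop
    exact he.mul (hφ.1.mul hm.aestronglyMeasurable)
  · rw [norm_mul, norm_cexp_I_inner, one_mul]
    exact norm_mul_exp_neg_le hα _ hs w

/-- For `s > 0` the exponential factor is at most one, so `α⁻¹ ‖w‖^α ‖φ w‖` dominates the derivative
of the integrand locally uniformly in `s`. -/
lemma hasDerivAt_stableFlow {α : ℝ} (hα : 0 < α) {φ : E d → ℂ} (hφ : Integrable φ)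
    (hφ' : Integrable fun w : E d => ((‖w‖ ^ α : ℝ) : ℂ) * φ w) (x : E d) {s : ℝ} (hs : 0 < s) :
    HasDerivAt (stableFlow α φ x)
      (-(α : ℂ)⁻¹ * stableFlow α (fun w => ((‖w‖ ^ α : ℝ) : ℂ) * φ w) x s) s := by
  have hm : ∀ s : ℝ, Measurable fun w : E d => ((Real.exp (-(s * ‖w‖ ^ α / α)) : ℝ) : ℂ) :=
    fun s => by fun_prop
  have he : AEStronglyMeasurable fun w : E d => Complex.exp (Complex.I * (⟪w, x⟫_ℝ : ℝ)) := by
    fun_prop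
  have hα' : (α : ℂ) ≠ 0 := by exact_mod_cast hα.ne'
  have h := hasDerivAt_integral_of_dominated_loc_of_deriv_le (μ := volume) (Ioi_mem_nhds hs)
    (F := fun s w => Complex.exp (Complex.I * (⟪w, x⟫_ℝ : ℝ)) *
      (φ w * ((Real.exp (-(s * ‖w‖ ^ α / α)) : ℝ) : ℂ)))
    (F' := fun s w => -(α : ℂ)⁻¹ * (Complex.exp (Complex.I * (⟪w, x⟫_ℝ : ℝ)) *
      (((‖w‖ ^ α : ℝ) : ℂ) * φ w * ((Real.exp (-(s * ‖w‖ ^ α / α)) : ℝ) : ℂ))))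
    (bound := fun w => ‖(α : ℂ)⁻¹‖ * ‖((‖w‖ ^ α : ℝ) : ℂ) * φ w‖)
    (Eventually.of_forall fun s => he.mul (hφ.1.mul (hm s).aestronglyMeasurable))
    (integrable_cexp_mul (hφ.mono (hφ.1.mul (hm s).aestronglyMeasurable)
      (Eventually.of_forall fun w => norm_mul_exp_neg_le hα _ hs.le w)) x)
    ((he.mul (hφ'.1.mul (hm s).aestronglyMeasurable)).const_mul _)
    (Eventually.of_forall fun w s (hs : 0 < s) => by
      rw [norm_mul, norm_neg, norm_mul, norm_cexp_I_inner, one_mul]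
      gcongr
      exact norm_mul_exp_neg_le hα _ hs.le w)
    (hφ'.norm.const_mul _)
    (Eventually.of_forall fun w s (hs : 0 < s) => by
      have h1 : HasDerivAt (fun s : ℝ => Real.exp (-(s * ‖w‖ ^ α / α)))
          (Real.exp (-(s * ‖w‖ ^ α / α)) * -(1 * ‖w‖ ^ α / α)) s :=
        ((((hasDerivAt_id s).mul_const _).div_const _).neg).exp
      have h2 := ((h1.ofReal_comp.const_mul (φ w)).const_mul
        (Complex.exp (Complex.I * (⟪w, x⟫_ℝ : ℝ))))
      refine h2.congr_deriv ?_
      push_cast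
      field_simp)
  have h2 := h.2.const_mul (((2 * Real.pi : ℝ) : ℂ)⁻¹ ^ d)
  refine h2.congr_deriv ?_
  rw [stableFlow, invF, integral_const_mul]
  ring

/-- Subtracting `u` removes the stray term `u'`. This leaves entropy differences unchanged, since
all the densities have the same mass. -/
lemma hasDerivAt_mul_log_sub {u : ℝ → ℝ} {u' s : ℝ} (hu : HasDerivAt u u' s) (hpos : 0 < u s) :
    HasDerivAt (fun s => u s * Real.log (u s) - u s) (u' * Real.log (u s)) s := by
  refine ((hu.mul (hu.log hpos.ne')).sub hu).congr_deriv ?_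
  field_simp
  ring

/-- The right derivative at time `0` of the entropy along a positive family of densities. -/
lemma tendsto_entropy_quotient {u q : ℝ → E d → ℝ} {α ε : ℝ} (hα : 0 < α) (hε : 0 < ε)
    {g : E d → ℝ} (hcont : ∀ t, 0 ≤ t → Continuous (u t)) (hpos : ∀ t, 0 ≤ t → ∀ x, 0 < u t x)
    (hint : ∀ t, 0 ≤ t → Integrable (u t)) (hone : ∀ t, 0 ≤ t → ∫ x, u t x = 1)
    (hu : ∀ x, ContinuousOn (fun t => u t x) (Set.Ici 0))
    (hq : ∀ x, ContinuousOn (fun t => q t x) (Set.Ici 0))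
    (hderiv : ∀ x, ∀ s, 0 < s → HasDerivAt (fun t => u t x) (-α⁻¹ * q s x) s)
    (hg : Integrable g)
    (hbound : ∀ᵐ x, ∀ t ∈ Set.Ico 0 ε, |Real.log (u t x) * q t x| ≤ g x)
    (hent : Integrable fun x => u 0 x * Real.log (u 0 x)) :
    Tendsto (fun t => (-(∫ x, u t x * Real.log (u t x)) - -∫ x, u 0 x * Real.log (u 0 x)) / t)
      (𝓝[>] 0) (𝓝 (α⁻¹ * ∫ x, Real.log (u 0 x) * q 0 x)) := by
  let F : E d → ℝ → ℝ := fun x t => u t x * Real.log (u t x) - u t x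
  have hFd : ∀ x s, 0 < s → HasDerivAt (F x) (-α⁻¹ * (Real.log (u s x) * q s x)) s := by
    intro x s hs
    refine (hasDerivAt_mul_log_sub (hderiv x s hs) (hpos s hs.le x)).congr_deriv ?_
    ring
  have hlog : ∀ x, ContinuousOn (fun t => Real.log (u t x)) (Set.Ici 0) := fun x =>
    (hu x).log fun t ht => (hpos t ht x).ne'
  have hFc : ∀ x, ContinuousOn (F x) (Set.Ici 0) := fun x => ((hu x).mul (hlog x)).sub (hu x)
  have hlim : ∀ x, Tendsto (fun t => (F x t - F x 0) / t) (𝓝[>] 0)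
      (𝓝 (-α⁻¹ * (Real.log (u 0 x) * q 0 x))) := by
    intro x
    have h1 : Tendsto (fun s => -α⁻¹ * (Real.log (u s x) * q s x)) (𝓝[>] 0)
        (𝓝 (-α⁻¹ * (Real.log (u 0 x) * q 0 x))) :=
      ((continuousOn_const.mul ((hlog x).mul (hq x))) 0 Set.self_mem_Ici).mono_left
        (nhdsWithin_mono _ Set.Ioi_subset_Ici_self)
    -- The evolution equation is available only for `s > 0`; the right derivative at `0` is the
    -- limit of the derivatives.
    have h2 : HasDerivWithinAt (F x) (-α⁻¹ * (Real.log (u 0 x) * q 0 x)) (Set.Ici 0) 0 := by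
      refine hasDerivWithinAt_Ici_of_tendsto_deriv (s := Set.Ioi 0)
        (fun s hs => (hFd x s hs).differentiableAt.differentiableWithinAt)
        (((hFc x) 0 Set.self_mem_Ici).mono Set.Ioi_subset_Ici_self) self_mem_nhdsWithin ?_
      refine h1.congr' ?_
      filter_upwards [self_mem_nhdsWithin] with s hs
      exact (hFd x s hs).deriv.symm
    have h3 := (hasDerivWithinAt_iff_tendsto_slope' (by simp)).1 h2.Ioi_of_Ici
    refine h3.congr fun t => ?_
    rw [slope_def_field, sub_zero]
  have hle : ∀ t ∈ Set.Ioo 0 ε, ∀ᵐ x, ‖(F x t - F x 0) / t‖ ≤ α⁻¹ * g x := by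
    intro t ht
    filter_upwards [hbound] with x hx
    obtain ⟨c, hc, hceq⟩ := exists_hasDerivAt_eq_slope (F x) _ ht.1
      -- By the mean value theorem the quotient is the derivative at some `c` in `(0, t)` depending
      -- on `x`. This is why one null set must serve all times in the bound.
      ((hFc x).mono Set.Icc_subset_Ici_self) (fun s hs => hFd x s hs.1)
    rw [sub_zero] at hceq
    rw [← hceq, norm_mul, norm_neg, Real.norm_eq_abs, Real.norm_eq_abs, abs_of_pos (by positivity)]
    gcongr
    exact hx c ⟨hc.1.le, hc.2.trans ht.2⟩
  have hFm : ∀ t, 0 ≤ t → Continuous fun x => F x t := fun t ht =>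
    ((hcont t ht).mul ((hcont t ht).log fun x => (hpos t ht x).ne')).sub (hcont t ht)
  have hmeas : ∀ t ∈ Set.Ioo 0 ε, AEStronglyMeasurable fun x => (F x t - F x 0) / t :=
    fun t ht => (((hFm t ht.1.le).sub (hFm 0 le_rfl)).div_const t).aestronglyMeasurable
  have hev : ∀ᶠ t in 𝓝[>] (0 : ℝ), t ∈ Set.Ioo 0 ε := Ioo_mem_nhdsGT hε
  have hmain := tendsto_integral_filter_of_dominated_convergence (μ := volume)
    (F := fun t x => (F x t - F x 0) / t) (l := 𝓝[>] (0 : ℝ)) _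
    (hev.mono hmeas) (hev.mono hle) (hg.const_mul α⁻¹) (Eventually.of_forall hlim)
  have hneg := hmain.neg
  rw [integral_const_mul, neg_mul, neg_neg] at hneg
  refine hneg.congr' ?_
  filter_upwards [hev] with t ht
  have ht0 : t ≠ 0 := ht.1.ne'
  have h4 : Integrable fun x => (F x t - F x 0) / t :=
    (hg.const_mul α⁻¹).mono' (hmeas t ht) (hle t ht)
  have h5 : Integrable fun x => F x t - F x 0 := by
    refine (h4.mul_const t).congr (Eventually.of_forall fun x => ?_)
    simp only
    field_simp
  have h6 : Integrable (F · 0) := hent.sub (hint 0 le_rfl)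
  have h7 : Integrable (F · t) := (h5.add h6).congr (Eventually.of_forall fun x => by simp)
  -- Integrability of `u t * log (u t)` at positive times is not assumed: it follows from that at
  -- time `0` and from the dominated increment.
  have h8 : Integrable fun x => u t x * Real.log (u t x) :=
    (h7.add (hint t ht.1.le)).congr (Eventually.of_forall fun x => by simp [F])
  rw [integral_div, integral_sub h7 h6, integral_sub h8 (hint t ht.1.le),
    integral_sub hent (hint 0 le_rfl), hone t ht.1.le, hone 0 le_rfl]
  ring

section

variable {Ω : Type*} [MeasurableSpace Ω] {P : Measure Ω} [IsProbabilityMeasure P] {α : ℝ}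
  {Y Z : Ω → E d} {p : E d → ℝ}

/-- The density of `Y + t ^ (1 / α) Z`, where `p` is the density of `Y`. -/
def perturbedDensity (P : Measure Ω) (α : ℝ) (Z : Ω → E d) (p : E d → ℝ) (t : ℝ) : E d → ℝ :=
  smoothed p (P.map fun ω => t ^ (1 / α) • Z ω)

lemma perturbedLaw_eq_withDensity (hY : Measurable Y) (hZ : Measurable Z) (hYZ : IndepFun Y Z P)
    (hp_pos : ∀ y, 0 < p y) (hp_cont : Continuous p) {C : ℝ} (hC : ∀ x, |p x| ≤ C)
    (hp : P.map Y = volume.withDensity fun y => ENNReal.ofReal (p y)) (t : ℝ) :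
    perturbedLaw P α Y Z t =
      volume.withDensity fun x => ENNReal.ofReal (perturbedDensity P α Z p t x) := by
  have hcZ : Measurable fun ω => t ^ (1 / α) • Z ω := hZ.fun_const_smul _
  have : IsProbabilityMeasure (P.map fun ω => t ^ (1 / α) • Z ω) :=
    Measure.isProbabilityMeasure_map hcZ.aemeasurable
  have hind : IndepFun (fun ω => t ^ (1 / α) • Z ω) Y P :=
    hYZ.symm.comp (φ := fun z : E d => t ^ (1 / α) • z) (measurable_const_smul _) measurable_id
  simp only [perturbedDensity]
  rw [← conv_eq_withDensity_smoothed hp_cont hC hp_pos, ← hp,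
    ← hind.map_add_eq_map_conv_map hcZ hY, perturbedLaw]
  congr 1
  funext ω
  simp [add_comm]

/-- The scale `γ = (1/α)^(1/α)` gives `γ^α = 1/α`, and scaling by `t^(1/α)` multiplies the exponent
by `t`, so the flow is linear in time. -/
lemma charFun_perturbedLaw (hα : 0 < α) (hY : Measurable Y) (hZ : Measurable Z)
    (hZlaw : IsReferenceStable P α Z) (hYZ : IndepFun Y Z P) {t : ℝ} (ht : 0 ≤ t) (w : E d) :
    charFun (perturbedLaw P α Y Z t) w =
      charFun (P.map Y) w * ((Real.exp (-(t * ‖w‖ ^ α / α)) : ℝ) : ℂ) := by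
  have hcZ : Measurable fun ω => t ^ (1 / α) • Z ω := hZ.fun_const_smul _
  have hind : IndepFun Y (fun ω => t ^ (1 / α) • Z ω) P :=
    hYZ.comp (ψ := fun z : E d => t ^ (1 / α) • z) measurable_id (measurable_const_smul _)
  have h1 : P.map (fun ω => t ^ (1 / α) • Z ω) = (P.map Z).map (t ^ (1 / α) • ·) := by
    rw [Measure.map_map (measurable_const_smul _) hZ]; rfl
  rw [perturbedLaw, hind.charFun_map_fun_add_eq_mul hY.aemeasurable hcZ.aemeasurable,
    Pi.mul_apply, h1, charFun_map_smul, hZlaw.2, norm_smul, Real.norm_eq_abs,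
    abs_of_nonneg (by positivity), Real.mul_rpow (by positivity) (by positivity),
    ← Real.rpow_mul (by positivity), ← Real.rpow_mul ht, one_div_mul_cancel hα.ne', Real.rpow_one,
    Real.rpow_one]
  congr 4
  ring

/-- The `α`-Fisher information exists and equals `∫ ln p · (-Δ)^(α/2) p`. -/
lemma tendsto_entropyQuotient (hα : 0 < α) (hY : Measurable Y) (hZ : Measurable Z)
    (hZlaw : IsReferenceStable P α Z) (hYZ : IndepFun Y Z P)
    (hp_pos : ∀ y, 0 < p y) (hp_cont : Continuous p)
    (hp : P.map Y = volume.withDensity fun y => ENNReal.ofReal (p y))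
    (h_ent : Integrable fun y => p y * Real.log (p y))
    (h_char : Integrable fun w : E d => ((‖w‖ ^ α : ℝ) : ℂ) * charFun (P.map Y) (-w))
    (h_reg : ∃ ε : ℝ, 0 < ε ∧ ∃ g : E d → ℝ, Integrable g ∧
      ∀ᵐ x : E d, ∀ t ∈ Set.Ico (0 : ℝ) ε,
        ‖(Real.log (density (perturbedLaw P α Y Z t) x) : ℂ) *
          fracInvFourier α (perturbedLaw P α Y Z t) x‖ ≤ g x) :
    Tendsto (entropyQuotient P α Y Z) (𝓝[>] 0)
        (𝓝 (α⁻¹ * ∫ x, Real.log (p x) * (fracInvFourier α (P.map Y) x).re)) ∧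
      Integrable fun x => Real.log (p x) * (fracInvFourier α (P.map Y) x).re := by
  obtain ⟨ε, hε, g, hg, hbound⟩ := h_reg
  have hμ : IsProbabilityMeasure (P.map Y) := Measure.isProbabilityMeasure_map hY.aemeasurable
  set φ : E d → ℂ := fun w => charFun (P.map Y) (-w)
  have hφ : Integrable φ := integrable_charFun_neg_of_norm_rpow_mul hα.le h_char
  have hinv : ∀ x, (p x : ℂ) = invF φ x :=
    eq_invF_charFun hp_cont (fun x => (hp_pos x).le) hp (by simpa [φ] using hφ.comp_neg)
  -- As the inverse transform of an integrable function, `p` is bounded, so its convolutions are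
  -- defined everywhere and continuous.
  obtain ⟨C, hC'⟩ := exists_norm_invF_le φ
  have hC : ∀ x, |p x| ≤ C := fun x => by
    rw [← Real.norm_eq_abs, ← Complex.norm_real, hinv]; exact hC' x
  have hcZ : ∀ t : ℝ, Measurable fun ω => t ^ (1 / α) • Z ω := fun t => hZ.fun_const_smul _
  have hν : ∀ t : ℝ, IsProbabilityMeasure (P.map fun ω => t ^ (1 / α) • Z ω) := fun t =>
    Measure.isProbabilityMeasure_map (hcZ t).aemeasurable
  have hlaw := perturbedLaw_eq_withDensity (α := α) hY hZ hYZ hp_pos hp_cont hC hp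
  have hcont : ∀ t, Continuous (perturbedDensity P α Z p t) := fun t =>
    continuous_smoothed hp_cont hC
  have hpos : ∀ t x, 0 < perturbedDensity P α Z p t x := fun t x =>
    smoothed_pos hp_cont hC hp_pos x
  have hdens : ∀ t, density (perturbedLaw P α Y Z t) = perturbedDensity P α Z p t := fun t =>
    density_eq_of_continuous (hcont t) (fun x => (hpos t x).le) (hlaw t)
  have hprob : ∀ t, IsProbabilityMeasure (perturbedLaw P α Y Z t) := fun t =>
    Measure.isProbabilityMeasure_map (hY.add (hcZ t)).aemeasurable
  have hchar : ∀ t, 0 ≤ t → ∀ w, charFun (perturbedLaw P α Y Z t) (-w) =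
      φ w * ((Real.exp (-(t * ‖w‖ ^ α / α)) : ℝ) : ℂ) := fun t ht w => by
    rw [charFun_perturbedLaw hα hY hZ hZlaw hYZ ht, norm_neg]
  -- Fourier inversion gives equality at every point, which the pointwise time derivative needs.
  have hflow : ∀ t, 0 ≤ t → ∀ x, (perturbedDensity P α Z p t x : ℂ) = stableFlow α φ x t := by
    intro t ht x
    have hchint : Integrable fun w => charFun (perturbedLaw P α Y Z t) (-w) := by
      refine hφ.mono (measurable_charFun.comp measurable_neg).aestronglyMeasurable
        (Eventually.of_forall fun w => ?_)
      rw [hchar t ht]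
      exact norm_mul_exp_neg_le hα _ ht w
    rw [eq_invF_charFun (hcont t) (fun x => (hpos t x).le) (hlaw t)
      (by simpa using hchint.comp_neg), stableFlow]
    congr 1
    exact funext fun w => hchar t ht w
  have hfrac : ∀ t, 0 ≤ t → ∀ x, fracInvFourier α (perturbedLaw P α Y Z t) x =
      stableFlow α (fun w => ((‖w‖ ^ α : ℝ) : ℂ) * φ w) x t := by
    intro t ht x
    change invF _ x = invF _ x
    congr 1
    funext w
    rw [hchar t ht, mul_assoc]
  have hp0 : perturbedDensity P α Z p 0 = p := by
    funext x
    have h := hflow 0 le_rfl x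
    have h2 : stableFlow α φ x 0 = (p x : ℂ) := by
      rw [hinv, stableFlow]
      simp
    rw [h2] at h
    exact_mod_cast h
  have hlaw0 : perturbedLaw P α Y Z 0 = P.map Y := by rw [hlaw, hp0, hp]
  have hq0 : ∀ x, fracInvFourier α (P.map Y) x =
      stableFlow α (fun w => ((‖w‖ ^ α : ℝ) : ℂ) * φ w) x 0 := fun x => by
    rw [← hlaw0, hfrac 0 le_rfl]
  have hb : ∀ᵐ x, ∀ t ∈ Set.Ico 0 ε, |Real.log (perturbedDensity P α Z p t x) *
      (stableFlow α (fun w => ((‖w‖ ^ α : ℝ) : ℂ) * φ w) x t).re| ≤ g x := by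
    filter_upwards [hbound] with x hx t ht
    refine le_trans ?_ (hx t ht)
    rw [hdens, hfrac t ht.1, norm_mul, abs_mul, Complex.norm_real, Real.norm_eq_abs]
    gcongr
    exact Complex.abs_re_le_norm _
  have hint : ∀ t, Integrable (perturbedDensity P α Z p t) := fun t => by
    have h := (withDensity_ofReal_integrable (hcont t) (fun x => (hpos t x).le) fun _ => 1).1
      (by rw [← hlaw t]; exact integrable_const _)
    simpa using h
  have hone : ∀ t, ∫ x, perturbedDensity P α Z p t x = 1 := fun t => by
    have h := withDensity_ofReal_integral (hcont t) (fun x => (hpos t x).le) fun _ => 1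
    rw [← hlaw t] at h
    simpa using h.symm
  have hre : ∀ t, 0 ≤ t → ∀ x, perturbedDensity P α Z p t x = (stableFlow α φ x t).re :=
    fun t ht x => by rw [← hflow t ht, Complex.ofReal_re]
  have hmain := tendsto_entropy_quotient (u := perturbedDensity P α Z p)
    (q := fun t x => (stableFlow α (fun w => ((‖w‖ ^ α : ℝ) : ℂ) * φ w) x t).re) hα hε
    (fun t _ => hcont t) (fun t _ => hpos t) (fun t _ => hint t) (fun t _ => hone t)
    (fun x => (Complex.continuous_re.comp_continuousOn (continuousOn_stableFlow hα hφ x)).congr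
      fun t ht => hre t ht x)
    (fun x => Complex.continuous_re.comp_continuousOn (continuousOn_stableFlow hα h_char x))
    (fun x s hs => by
      have h1 := hasDerivAt_stableFlow hα hφ h_char x hs
      have h2 : HasDerivAt (fun t => (stableFlow α φ x t).re) _ s :=
        Complex.reCLM.hasFDerivAt.comp_hasDerivAt s h1
      -- Density and flow are identified only for nonnegative times; near `s > 0` this is a full
      -- neighbourhood.
      have h3 : (fun t => perturbedDensity P α Z p t x) =ᶠ[𝓝 s]
          fun t => (stableFlow α φ x t).re := by
        filter_upwards [Ioi_mem_nhds hs] with t ht using hre t (le_of_lt ht) x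
      refine (h2.congr_of_eventuallyEq h3).congr_deriv ?_
      rw [Complex.reCLM_apply, ← Complex.ofReal_inv, ← Complex.ofReal_neg, Complex.re_ofReal_mul])
    hg hb (by rw [hp0]; exact h_ent)
  refine ⟨?_, ?_⟩
  · simp only [hq0]
    rw [hp0] at hmain
    refine hmain.congr fun t => ?_
    rw [entropyQuotient, diffEntropy, diffEntropy, hdens, ← hlaw0, hdens, hp0]
  · have hqc : Continuous (fracInvFourier α (P.map Y)) := continuous_invF h_char
    refine hg.mono' ((hp_cont.log fun x => (hp_pos x).ne').mul
      (Complex.continuous_re.comp hqc)).aestronglyMeasurable ?_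
    filter_upwards [hb] with x hx
    have h := hx 0 ⟨le_rfl, hε⟩
    rw [hp0, ← hq0] at h
    exact h

end

/-! ### Translation families and symmetry of the Riesz potential. -/

lemma fderiv_comp_sub_left {L : E d → ℝ} (hL : Differentiable ℝ L) (x η v : E d) :
    fderiv ℝ (fun η => L (x - η)) η v = -fderiv ℝ L (x - η) v := by
  have h : HasFDerivAt (fun η => L (x - η)) _ η :=
    (hL (x - η)).hasFDerivAt.comp η ((hasFDerivAt_id η).const_sub x)
  rw [h.fderiv]
  simp

/-- The reflection changes the sign of each first derivative, and the two signs cancel at second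
order. -/
lemma laplacian_comp_sub_left {L : E d → ℝ} (hL : ContDiff ℝ 2 L) (x η : E d) :
    Laplacian.laplacian (fun η => L (x - η)) η = Laplacian.laplacian L (x - η) := by
  have hLx : ContDiff ℝ 2 fun η => L (x - η) := hL.comp (contDiff_const.sub contDiff_id)
  rw [laplacian_eq_sum_fderiv hLx, laplacian_eq_sum_fderiv hL]
  refine Finset.sum_congr rfl fun i _ => ?_
  have hL1 : Differentiable ℝ L := hL.differentiable (by simp)
  have hL2 : Differentiable ℝ fun y => fderiv ℝ L y (EuclideanSpace.basisFun (Fin d) ℝ i) :=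
    ((hL.fderiv_right (m := 1) (by norm_num)).clm_apply contDiff_const).differentiable (by simp)
  simp_rw [fderiv_comp_sub_left hL1]
  rw [fderiv_fun_neg, neg_apply, fderiv_comp_sub_left hL2, neg_neg]

lemma paramLaplacianLog_translation {Ω : Type*} [MeasurableSpace Ω] {P : Measure Ω}
    {Y : Ω → E d} (hY : Measurable Y) {p : E d → ℝ} (hp_pos : ∀ y, 0 < p y)
    (hp_smooth : ContDiff ℝ 2 p)
    (hp : P.map Y = volume.withDensity fun y => ENNReal.ofReal (p y)) (x η : E d) :
    paramLaplacianLog P (fun η ω => Y ω + η) x η =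
      Laplacian.laplacian (fun y => Real.log (p y)) (x - η) := by
  have hdens : ∀ η, density (P.map fun ω => Y ω + η) = fun y => p (y - η) := by
    intro η
    refine density_eq_of_continuous (hp_smooth.continuous.comp (continuous_id.sub
      continuous_const)) (fun y => (hp_pos _).le) ?_
    have h1 : P.map (fun ω => Y ω + η) = (P.map Y).map (· + η) := by
      rw [Measure.map_map (by fun_prop) hY]; rfl
    have hpm : Measurable p := hp_smooth.continuous.measurable
    rw [h1, hp]
    ext s hs
    rw [Measure.map_apply (by fun_prop) hs, withDensity_apply _ hs,
      withDensity_apply _ (measurable_add_const η hs), ← lintegral_indicator hs,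
      ← lintegral_indicator (measurable_add_const η hs)]
    conv_rhs => rw [← lintegral_add_right_eq_self _ η]
    refine lintegral_congr fun y => ?_
    by_cases hy : y + η ∈ s <;> simp [Set.indicator, hy]
  unfold paramLaplacianLog
  simp_rw [hdens]
  exact laplacian_comp_sub_left (hp_smooth.log fun y => (hp_pos y).ne') x η

lemma norm_sub_add_sub_left (y θ t : E d) : ‖θ - (y + θ - t)‖ = ‖y - t‖ := by
  rw [norm_sub_rev]
  congr 1
  abel

lemma rieszConverges_comp_sub_left_iff {ν : ℝ} (A : E d → ℝ) (y θ : E d) :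
    RieszConverges ν (fun η => A (y + θ - η)) θ ↔ RieszConverges ν A y := by
  unfold RieszConverges
  rw [← integrable_comp_sub_left _ (y + θ)]
  simp [norm_sub_add_sub_left]

/-- The point reflection `η ↦ y + θ - η` preserves volume and distances and exchanges `θ` with `y`.
Evaluating at the observation `y + θ` therefore removes the parameter. -/
lemma riesz_comp_sub_left {ν : ℝ} (A : E d → ℝ) (y θ : E d) :
    riesz ν (fun η => A (y + θ - η)) θ = riesz ν A y := by
  unfold riesz
  rw [← integral_sub_left_eq_self _ _ (y + θ)]
  simp [norm_sub_add_sub_left]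

lemma rieszConst_pos (hd : 0 < d) {ν : ℝ} (hν0 : 0 < ν) (hν : ν < 1) : 0 < rieszConst d ν := by
  have hd1 : (1 : ℝ) ≤ d := by exact_mod_cast hd
  have h1 := Real.Gamma_pos_of_pos (show 0 < ν / 2 by linarith)
  have h2 := Real.Gamma_pos_of_pos (show 0 < (d : ℝ) / 2 - ν / 2 by linarith)
  unfold rieszConst
  positivity

/-- The Riesz potential is symmetric. -/
lemma integral_riesz_mul_comm (hd : 0 < d) {ν : ℝ} (hν0 : 0 ≤ ν) (hν : ν < 1) {p A : E d → ℝ}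
    (hp_pos : ∀ y, 0 < p y) (hp : Continuous p) (hA : Continuous A)
    (hconv : ∀ x, RieszConverges ν p x) (hint : Integrable fun y => |A y| * riesz ν p y) :
    (∀ᵐ y, RieszConverges ν A y) ∧ Integrable (fun y => riesz ν A y * p y) ∧
      ∫ y, riesz ν A y * p y = ∫ y, riesz ν p y * A y := by
  rcases hν0.eq_or_lt with rfl | hν0
  · refine ⟨Eventually.of_forall fun y h => absurd rfl h, ?_, ?_⟩
    · refine hint.mono (by
      have h : AEStronglyMeasurable fun y => A y * p y := (hA.mul hp).aestronglyMeasurable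
      simpa [riesz] using h)
        (Eventually.of_forall fun y => ?_)
      simp [riesz]
    · simp [riesz, mul_comm]
  have hκ := rieszConst_pos hd hν0 hν
  have hr : ∀ (f : E d → ℝ) x, riesz ν f x =
      (rieszConst d ν)⁻¹ * ∫ y, ‖x - y‖ ^ (-(d : ℝ) + ν) * f y := fun f x => by
    rw [riesz, if_neg hν0.ne']
  let K : E d × E d → ℝ := fun z => ‖z.1 - z.2‖ ^ (-(d : ℝ) + ν) * p z.2 * A z.1
  have hKm : Measurable K := by
    have := hp.measurable
    have := hA.measurable
    fun_prop
  -- Integrating out the variable of `p` first yields a constant times `|A| I_ν[p]`, so the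
  -- integrability hypothesis is exactly Tonelli's condition.
  have hK : Integrable K (volume.prod volume) := by
    rw [integrable_prod_iff hKm.aestronglyMeasurable]
    refine ⟨Eventually.of_forall fun u => (hconv u hν0.ne').mul_const (A u), ?_⟩
    refine (hint.const_mul (rieszConst d ν)).congr (Eventually.of_forall fun u => ?_)
    simp only [K, hr]
    have : ∀ y, ‖‖u - y‖ ^ (-(d : ℝ) + ν) * p y * A u‖ =
        ‖u - y‖ ^ (-(d : ℝ) + ν) * p y * |A u| := by
      intro y
      rw [norm_mul, Real.norm_eq_abs, abs_of_nonneg (mul_nonneg (by positivity) (hp_pos y).le),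
        Real.norm_eq_abs]
    simp_rw [this]
    rw [integral_mul_const]
    field_simp
  have hKs : ∀ y, ∫ u, K (u, y) = rieszConst d ν * (riesz ν A y * p y) := by
    intro y
    have : ∀ u, K (u, y) = ‖y - u‖ ^ (-(d : ℝ) + ν) * A u * p y := fun u => by
      simp only [K]
      rw [norm_sub_rev]
      ring
    simp_rw [this]
    rw [integral_mul_const, hr]
    field_simp
  refine ⟨?_, ?_, ?_⟩
  -- Almost every section of `K` is integrable; dividing by `p y > 0` leaves the integrand of
  -- `I_ν[A]`.
  · filter_upwards [hK.prod_left_ae] with y hy _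
    refine (hy.mul_const (p y)⁻¹).congr (Eventually.of_forall fun u => ?_)
    simp only [K]
    have := (hp_pos y).ne'
    rw [norm_sub_rev]
    field_simp
  · refine (hK.integral_prod_right.const_mul (rieszConst d ν)⁻¹).congr
      (Eventually.of_forall fun y => ?_)
    simp only [hKs]
    field_simp
  · have h1 : ∫ y, ∫ u, K (u, y) = ∫ u, ∫ y, K (u, y) :=
      (integral_integral_swap (f := fun u y => K (u, y)) hK).symm
    simp_rw [hKs] at h1
    have h2 : ∀ u, ∫ y, K (u, y) = rieszConst d ν * (riesz ν p u * A u) := by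
      intro u
      simp only [K]
      rw [integral_mul_const, hr]
      field_simp
    simp_rw [h2, integral_const_mul] at h1
    exact mul_left_cancel₀ hκ.ne' h1

end AlphaFisher

end

/-! ### Assembly of the identities. -/

open AlphaFisher in
theorem mainTheorem7
    {d : ℕ} (hd : 0 < d) {α : ℝ} (hα : 1 < α) (hα2 : α ≤ 2)
    {Ω : Type*} [MeasurableSpace Ω] (P : Measure Ω) [IsProbabilityMeasure P]
    (Y Z : Ω → E d) (hY : Measurable Y) (hZ : Measurable Z)
    -- `Z` is a reference symmetric stable vector independent of `Y`
    (hZlaw : IsReferenceStable P α Z) (hYZ : IndepFun Y Z P)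
    -- `Y` has a positive density `p`, smooth enough for `Δ ln p` to make sense
    (p : E d → ℝ) (hp_pos : ∀ y, 0 < p y) (hp_smooth : ContDiff ℝ 2 p)
    (hp : P.map Y = volume.withDensity (fun y => ENNReal.ofReal (p y)))
    -- finite differential entropy and finite logarithmic moment
    (h_ent : Integrable (fun y => p y * Real.log (p y)))
    (h_log : Integrable (fun y => Real.log (1 + ‖y‖) * p y))
    -- `‖w‖ ^ α φ_Y(-w)` is integrable
    (h_char : Integrable (fun w : E d => ((‖w‖ ^ α : ℝ) : ℂ) * charFun (P.map Y) (-w)))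
    -- the regularity condition on the perturbed densities, uniformly in `t ∈ [0, ε)`
    (h_reg : ∃ ε : ℝ, 0 < ε ∧ ∃ g : E d → ℝ, Integrable g ∧
      ∀ᵐ x : E d, ∀ t ∈ Set.Ico (0 : ℝ) ε,
        ‖(Real.log (density (perturbedLaw P α Y Z t) x) : ℂ) *
          fracInvFourier α (perturbedLaw P α Y Z t) x‖ ≤ g x)
    -- the boundary terms at infinity in Green's identity vanish
    (h_bdry₁ : Tendsto
      (sphereFlux (fun y => Real.log (p y) • ∇ (riesz (2 - α) p) y)) atTop (𝓝 0))
    (h_bdry₂ : Tendsto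
      (sphereFlux (fun y => riesz (2 - α) p y • ∇ (fun z => Real.log (p z)) y)) atTop (𝓝 0))
    -- `|Δ ln p| I_{2-α}(p)` is integrable
    (h_int : Integrable (fun y =>
      |Laplacian.laplacian (fun z => Real.log (p z)) y| * riesz (2 - α) p y))
    (θ : E d) :
    HasAlphaFisherInfo P α Y Z ∧
      HasParamFisherInfo P α (fun η ω => Y ω + η) θ ∧
      paramFisherInfo P α (fun η ω => Y ω + η) θ = alphaFisherInfo P α Y Z := by
  have hp0 : ∀ y, 0 ≤ p y := fun y => (hp_pos y).le
  have hμ : IsProbabilityMeasure (P.map Y) := Measure.isProbabilityMeasure_map hY.aemeasurable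
  have hcont := hp_smooth.continuous
  have hlog : ContDiff ℝ 2 fun z => Real.log (p z) := hp_smooth.log fun y => (hp_pos y).ne'
  have hφ := integrable_charFun_neg_of_norm_rpow_mul (by linarith) h_char
  set A : E d → ℝ := Laplacian.laplacian fun z => Real.log (p z) with hA
  have hAc : Continuous A := continuous_laplacian hlog
  obtain ⟨hlim, hint⟩ := tendsto_entropyQuotient (by linarith) hY hZ hZlaw hYZ hp_pos hcont hp
    h_ent h_char h_reg
  obtain ⟨hRsmooth, hRlap⟩ := contDiff_riesz_and_laplacian_riesz hd hα hα2 hcont hp0 hp h_char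
  have hconv : ∀ x, RieszConverges (2 - α) p x := fun x =>
    (rieszConverges_and_riesz_eq_invF hd (by linarith) (by linarith) hcont hp0 hp hφ x).1
  obtain ⟨hconvA, hintA, hsymm⟩ := integral_riesz_mul_comm hd (by linarith) (by linarith) hp_pos
    hcont hAc hconv h_int
  have hlapint : Integrable fun x => Real.log (p x) * Laplacian.laplacian (riesz (2 - α) p) x := by
    simpa [hRlap] using hint.neg
  have hRAint : Integrable fun x => riesz (2 - α) p x * A x := by
    refine h_int.mono (hRsmooth.continuous.mul hAc).aestronglyMeasurable
      (Eventually.of_forall fun x => ?_)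
    simp [mul_comm]
  have hgreen := integral_mul_laplacian_comm hd hlog hRsmooth h_bdry₁ h_bdry₂ hlapint hRAint
  have hlapeq : ∀ x, paramLaplacianLog P (fun η ω => Y ω + η) x = fun η => A (x - η) := fun x =>
    funext fun η => paramLaplacianLog_translation hY hp_pos hp_smooth hp x η
  have hscore : paramScore P α (fun η ω => Y ω + η) θ = fun ω => riesz (2 - α) A (Y ω) := by
    funext ω
    rw [paramScore, hlapeq, riesz_comp_sub_left]
  have hintμ : Integrable (riesz (2 - α) A) (P.map Y) := by
    rwa [hp, withDensity_ofReal_integrable hcont hp0]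
  refine ⟨⟨_, hlim⟩, ⟨?_, ?_⟩, ?_⟩
  · have h1 : ∀ᵐ y ∂(P.map Y), RieszConverges (2 - α) A y := by
      rw [hp]
      -- The law of `Y` is absolutely continuous, so convergence at Lebesgue-almost every point
      -- becomes almost sure convergence.
      exact (withDensity_absolutelyContinuous _ _).ae_le hconvA
    filter_upwards [ae_of_ae_map hY.aemeasurable h1] with ω hω
    rw [hlapeq]
    exact (rieszConverges_comp_sub_left_iff A (Y ω) θ).2 hω
  · rw [hscore]
    exact hintμ.comp_measurable hY
  -- The expectation becomes an integral against `p`; kernel symmetry and Green's identity then lead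
  -- to `-∫ ln p · ΔR`. The factor `α` cancels the `α⁻¹` of the entropy derivative, and the sign
  -- comes from `ΔR = -q`.
  · rw [paramFisherInfo, hscore, ← integral_map hY.aemeasurable hintμ.1, hp,
      withDensity_ofReal_integral hcont hp0, hsymm, ← hgreen, alphaFisherInfo, hlim.limUnder_eq,
      mul_inv_cancel_left₀ (by linarith)]
    simp_rw [hRlap, mul_neg]
    rw [integral_neg, neg_neg]
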